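/- Let $\alpha>0$, $c>0$, $\underline w>0$ and $a\in\mathbb R$. There is a constant $C=C(c,\underline w,a,\alpha)>0$ with the following property. Let $n\in\mathbb N$, $T\in(0,\infty]$, and let $u\colon\mathbb R^n\times[0,T)\to[0,\infty]$ be continuous and such that $\{x\in\mathbb R^n: u(x,t)\le a\}$ is compact for every $t\in[0,T)$ (the value $u=\infty$ means that there is no hypersurface over that point). Let $M_t=\operatorname{graph}u(\cdot,t)$. Assume that on $\{(x,t): u(x,t)<a+1\}$ the function $u$ is smooth for $t>0$, that there $u(\cdot,0)$ is $C^2$ and the spatial derivatives $\nabla u,\nabla^2u$ are continuous up to $t=0$, that the mean curvature $H$ of $M_t$ is positive there, and that for $t>0$ this part of $M_t$ moves by the graphical $H^\alpha$-flow $\langle\dot X,\nu\rangle=H^\alpha$. That is, $$\frac{\partial_t u}{\sqrt{1+|\nabla u|^2}}=H^\alpha .$$ Here $X(x,t)=(x,u(x,t))$, $\nu=(-\nabla u,1)/\sqrt{1+|\nabla u|^2}$, $g_{ij}=\langle X_i,X_j\rangle$, $h_{ij}=\langle X_{ij},\nu\rangle$, $H=g^{ij}h_{ij}$ and $|A|^2=g^{ik}g^{jl}h_{ij}h_{kl}$.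 Let $\psi=(a-X^{n+1})_+=(a-u)_+$ and $w=\langle\nu,e_{n+1}\rangle$, and assume that on $\{\psi>0\}$ $$w\ge 2\underline w\qquad\text{and}\qquad c\le\tfrac12H^\alpha\le c^{-1}.$$ Then $\sup_{t=0}\psi|A|<\infty$ and, for all $t\in[0,T)$, everywhere on $M_t$, $$\psi\,|A|\le C\,\max\Big\{\sup_{t=0}\psi\,|A|,\;1\Big\},$$ where $\psi|A|$ is understood to be $0$ where $\psi=0$. -/

import Mathlib

open scoped ContDiff RealInnerProductSpace

noncomputable section

namespace HFlow

/-- The parameter domain `ℝⁿ` with its Euclidean structure. -/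
abbrev Base (n : ℕ) : Type := EuclideanSpace ℝ (Fin n)

/-- The ambient Euclidean space `ℝⁿ⁺¹`; the last coordinate is the height. -/
abbrev Amb (n : ℕ) : Type := EuclideanSpace ℝ (Fin (n + 1))

/-- The point `(x, r) ∈ ℝⁿ⁺¹` for `x ∈ ℝⁿ` and `r ∈ ℝ`. -/
def point {n : ℕ} (x : Base n) (r : ℝ) : Amb n :=
  WithLp.toLp 2 (Fin.snoc (α := fun _ => ℝ) (fun i => x i) r)

/-- The upward unit vector `e_{n+1} = (0, …, 0, 1)`. -/
def vertical (n : ℕ) : Amb n := point 0 1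

/-! ### Hypersurfaces given by a parametrization `X : ℝⁿ → ℝⁿ⁺¹` -/

/-- The `i`-th partial derivative of a vector valued map on `ℝⁿ`. -/
def pderiv {n : ℕ} {F : Type*} [NormedAddCommGroup F] [NormedSpace ℝ F]
    (i : Fin n) (f : Base n → F) (x : Base n) : F :=
  fderiv ℝ f x (EuclideanSpace.single i 1)

/-- The induced metric `g_{ij} = ⟨X_i, X_j⟩`. -/
def metric {n : ℕ} (X : Base n → Amb n) (x : Base n) : Matrix (Fin n) (Fin n) ℝ :=
  Matrix.of fun i j => ⟪pderiv i X x, pderiv j X x⟫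

/-- The second fundamental form `h_{ij} = ⟨X_{ij}, ν⟩` with respect to the normal field `ν`. -/
def secondForm {n : ℕ} (X ν : Base n → Amb n) (x : Base n) : Matrix (Fin n) (Fin n) ℝ :=
  Matrix.of fun i j => ⟪pderiv j (pderiv i X) x, ν x⟫

/-- The mean curvature `H = g^{ij} h_{ij}`. -/
def meanCurvature {n : ℕ} (X ν : Base n → Amb n) (x : Base n) : ℝ :=
  ∑ i, ∑ j, (metric X x)⁻¹ i j * secondForm X ν x i j

/-- The norm `|A|` of the second fundamental form, `|A|² = g^{ik} g^{jl} h_{ij} h_{kl}`. -/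
def normA {n : ℕ} (X ν : Base n → Amb n) (x : Base n) : ℝ :=
  Real.sqrt (∑ i, ∑ j, ∑ k, ∑ l,
    (metric X x)⁻¹ i k * (metric X x)⁻¹ j l * secondForm X ν x i j * secondForm X ν x k l)

/-! ### Graphs -/

/-- The graphical parametrization `X(x) = (x, f(x))`. -/
def graphMap {n : ℕ} (f : Base n → ℝ) (x : Base n) : Amb n := point x (f x)

/-- The upward unit normal `ν = (-∇f, 1) / √(1 + |∇f|²)` of the graph of `f`. -/
def graphNormal {n : ℕ} (f : Base n → ℝ) (x : Base n) : Amb n :=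
  (Real.sqrt (1 + ‖gradient f x‖ ^ 2))⁻¹ • point (-gradient f x) 1

/-- The gradient function `w = ⟨ν, e_{n+1}⟩` of the graph of `f`. -/
def graphW {n : ℕ} (f : Base n → ℝ) (x : Base n) : ℝ := ⟪graphNormal f x, vertical n⟫

/-- The mean curvature `H` of the graph of `f` with respect to the upward unit normal. -/
def graphH {n : ℕ} (f : Base n → ℝ) (x : Base n) : ℝ :=
  meanCurvature (graphMap f) (graphNormal f) x

/-- `|A|` for the graph of `f`. -/
def graphA {n : ℕ} (f : Base n → ℝ) (x : Base n) : ℝ :=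
  normA (graphMap f) (graphNormal f) x

/-! ### Graphical flows below a given height

A time-dependent graph is described by its extended height function
`u : ℝⁿ × [0, T) → [-∞, ∞]`; the value `∞` is taken at the points over which there is no
hypersurface. -/

/-- The time interval `[0, T)`, where `T = ∞` is allowed. -/
def timeInterval (T : EReal) : Set ℝ := {t | 0 ≤ t ∧ (t : EReal) < T}

/-- The space-time set `{(x, t) : t ∈ [0, T), u(x, t) < a}`. -/
def belowHeight {n : ℕ} (T : EReal) (u : Base n → ℝ → EReal) (a : ℝ) : Set (Base n × ℝ) :=
  {p | p.2 ∈ timeInterval T ∧ u p.1 p.2 < (a : EReal)}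

/-- The real valued function `u(·, t)`; it is only used where `u(·, t)` is finite. -/
def slice {n : ℕ} (u : Base n → ℝ → EReal) (t : ℝ) (x : Base n) : ℝ := (u x t).toReal

/-- The localization function `ψ = (a - Xⁿ⁺¹)₊` as a function of `(x, t)`. -/
def cutoff {n : ℕ} (u : Base n → ℝ → EReal) (a : ℝ) (x : Base n) (t : ℝ) : ℝ :=
  (max ((a : EReal) - u x t) 0).toReal

/-- `M_t = graph u(·, t)`, `t ∈ [0, T)`, is a family of graphs in the upper half-space whose parts
below height `a + 1` are smooth, strictly mean convex and move by the `H^α`-flow, and whose parts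
of height at most `a` are compact. -/
structure IsGraphicalFlowBelow {n : ℕ} (α a : ℝ) (T : EReal) (u : Base n → ℝ → EReal) :
    Prop where
  T_pos : 0 < T
  continuousOn : ContinuousOn (fun p : Base n × ℝ => u p.1 p.2) (Set.univ ×ˢ timeInterval T)
  nonneg : ∀ t ∈ timeInterval T, ∀ x, 0 ≤ u x t
  isCompact_sublevel : ∀ t ∈ timeInterval T, IsCompact {x | u x t ≤ (a : EReal)}
  /-- smoothness for positive times -/
  smooth : ContDiffOn ℝ ∞ (fun p : Base n × ℝ => slice u p.2 p.1)
    (belowHeight T u (a + 1) ∩ {p | 0 < p.2})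
  /-- the initial hypersurface is twice continuously differentiable, and the first and second
  space derivatives are continuous up to the initial time -/
  initial_regular : ContDiffOn ℝ 2 (slice u 0) {x | u x 0 < ((a + 1 : ℝ) : EReal)}
  continuousOn_fderiv : ContinuousOn (fun p : Base n × ℝ => fderiv ℝ (slice u p.2) p.1)
    (belowHeight T u (a + 1))
  continuousOn_fderiv_fderiv :
    ContinuousOn (fun p : Base n × ℝ => fderiv ℝ (fderiv ℝ (slice u p.2)) p.1)
      (belowHeight T u (a + 1))
  meanConvex : ∀ p ∈ belowHeight T u (a + 1), 0 < graphH (slice u p.2) p.1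
  /-- the flow equation `⟨∂X/∂t, ν⟩ = H^α` -/
  flow : ∀ p ∈ belowHeight T u (a + 1), 0 < p.2 →
    ⟪deriv (fun s => graphMap (slice u s) p.1) p.2, graphNormal (slice u p.2) p.1⟫
      = graphH (slice u p.2) p.1 ^ α

end HFlow

end

/-!
The proof is a parabolic maximum principle for the quotient `ψ|A| / χ`, where `χ` is a concave
function of the speed `f = H^α`.

**Evolution equations.** For the graph of `u`, put `w = 1/√(1 + |∇u|²)` and `p_i = w u_i`. Then
`g^{ij} = δ_ij - p_i p_j` and the shape operator is `S_ij = ∂_j p_i`, so that `H = tr S = div p`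
and `|A|² = tr S²` involve no inverse matrix. All evolution equations follow from the symmetry
of `S P`, `P = (g^{ij})` (`FormalGraph.S_codazzi`), its divergence
(`FormalGraph.laplace_p`, the equation for `Δν`), and the flow equation. Differentiation enters
only through commuting derivations, so these identities are proved in an arbitrary commutative
`ℝ`-algebra with derivations (`FormalGraph`, `FormalFlow`) and then applied to the algebra of
smooth functions on an open set of space-time. With `𝓛 = D_t - f'(H) Δ`, where `D_t` is the time
derivative along the normal motion, the result is
* `𝓛 f = f' f |A|²` (`FormalFlow.L_f`),
* `½ 𝓛 |A|² = f'' ⟨A, ∇H ⊗ ∇H⟩ + f' |A|⁴ + (f - f' H) tr A³ - f' |∇A|²` (`FormalFlow.L_q`),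
  where `|∇A|²` is identified by `FormalFlow.R_eq`,
* `𝓛 u = (f - f' H) w` (`FormalFlow.L_U`).

**The maximum point.** Take `χ = f - c - μ f²` with `μ = c³/8`. At a positive maximum of `ψ|A|/χ`
the gradient of `log |A|` is that of `log (χ/ψ)`, and Kato's inequality `|∇A|² ≥ |∇|A||²`
(`FormalFlow.kato`) makes the `|∇χ|²` terms cancel. The remaining reaction term is
`-(f χ' - χ)/χ · |A|²`, negative because of the constant `c` in `χ`, and strict concavity of `χ`
leaves a term `-2μ|∇f|²/χ`. All other terms, including `f'' ⟨A, ∇H ⊗ ∇H⟩/|A|² ≤ K |∇f|²/|A|`, are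
of lower order in `|A|` once `ψ|A|` is large (`ψ ≤ a` since `u ≥ 0`). So `ψ|A|` is bounded by
`threshold α c a` at such a point unless it lies at time zero (`FormalFlow.ev_curvature_le`,
`curvature_le_of_isMax`).

**Existence of the maximum.** Positivity of the speed makes `u` nondecreasing in time below height
`a + 1`, so the sublevel sets `{u(·, t) ≤ a}` shrink (`IsGraphicalFlowBelow.le_of_le_time`) and
`{u ≤ a}` is compact over bounded time intervals (`IsGraphicalFlowBelow.isCompact_below`).
-/

namespace HFlow

open scoped Topology

/-! ### Graphs over an algebra with commuting derivations -/

/-- The differential algebra of a time-dependent graph: a commutative algebra with commuting space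
derivations `δ i` and a time derivation `τ`, the height function `U`, and `w = 1/√(1 + |∇U|²)`,
which is determined up to sign by `w_sq`. -/
structure FormalGraph (ι A : Type*) [Fintype ι] [CommRing A] [Algebra ℝ A] where
  δ : ι → Derivation ℝ A A
  τ : Derivation ℝ A A
  U : A
  w : A
  δ_comm : ∀ i j x, δ i (δ j x) = δ j (δ i x)
  τ_comm : ∀ i x, τ (δ i x) = δ i (τ x)
  w_sq : w * w * (1 + ∑ i, δ i U * δ i U) = 1

namespace FormalGraph

section

variable {ι A : Type*} [Fintype ι] [CommRing A] [Algebra ℝ A] (F : FormalGraph ι A)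

/-- The negative of the horizontal part of the unit normal, `p_i = w ∂_i U`. -/
def p (i : ι) : A := F.w * F.δ i F.U

/-- The second fundamental form `h_ij = w ∂_j ∂_i U`. -/
def h (i j : ι) : A := F.w * F.δ j (F.δ i F.U)

/-- The shape operator `S_ij = ∂_j p_i`; it is `g^{ik} h_kj` by `S_eq`. -/
def S (i j : ι) : A := F.δ j (F.p i)

/-- The mean curvature `H = tr S`. -/
def H : A := ∑ i, F.S i i

/-- The vector `S p`. -/
def r (i : ι) : A := ∑ j, F.S i j * F.p j

/-- The squared norm `|A|² = tr S²`. -/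
def q : A := ∑ i, ∑ j, F.S i j * F.S j i

lemma h_symm (i j : ι) : F.h i j = F.h j i := by
  simp only [h, F.δ_comm i j]

/-- The factor `2` coming from the squares in `w_sq` is cancelled with the help of the `ℝ`-algebra
structure. -/
lemma derivation_w (d : Derivation ℝ A A) :
    d F.w = - F.w * ∑ k, F.p k * (F.w * d (F.δ k F.U)) := by
  have h1 := congrArg d F.w_sq
  have h2 : (2 : A) * (F.w * d F.w * (1 + ∑ i, F.δ i F.U * F.δ i F.U)
      + F.w * F.w * ∑ i, F.δ i F.U * d (F.δ i F.U)) = 0 := by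
    simp only [Derivation.leibniz, map_add, map_sum, Derivation.map_one_eq_zero, smul_eq_mul] at h1
    rw [← h1, Finset.sum_add_distrib]
    ring
  -- cancel the factor `2`
  have h3 : F.w * d F.w * (1 + ∑ i, F.δ i F.U * F.δ i F.U)
      + F.w * F.w * ∑ i, F.δ i F.U * d (F.δ i F.U) = 0 := by
    have := congrArg (fun x => (2⁻¹ : ℝ) • x) h2
    simpa [← smul_mul_assoc, ← algebraMap_smul (R := ℝ) A, ← mul_assoc, ← map_ofNat (algebraMap ℝ A),
      ← map_mul] using this
  have h4 : ∑ k, F.p k * (F.w * d (F.δ k F.U)) = F.w * F.w * ∑ i, F.δ i F.U * d (F.δ i F.U) := by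
    rw [Finset.mul_sum]
    exact Finset.sum_congr rfl fun i _ => by rw [p]; ring
  rw [h4]
  linear_combination F.w * h3 - d F.w * F.w_sq

lemma δ_S_comm (i j k : ι) : F.δ i (F.S k j) = F.δ j (F.S k i) := F.δ_comm i j _

lemma δ_H (k : ι) : F.δ k F.H = ∑ j, F.δ j (F.S j k) := by
  rw [H, map_sum]
  exact Finset.sum_congr rfl fun j _ => F.δ_comm _ _ _

end

variable {ι A : Type*} [Fintype ι] [DecidableEq ι] [CommRing A] [Algebra ℝ A]
  (F : FormalGraph ι A)

/-- The inverse metric `g^{ij} = δ_ij - p_i p_j`. -/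
def P (i j : ι) : A := (if i = j then 1 else 0) - F.p i * F.p j

lemma P_symm (i j : ι) : F.P i j = F.P j i := by
  simp only [P, eq_comm (a := i), mul_comm (F.p i)]

lemma derivation_p (d : Derivation ℝ A A) (i : ι) :
    d (F.p i) = ∑ k, F.P i k * (F.w * d (F.δ k F.U)) := by
  have : d (F.p i) = F.w * d (F.δ i F.U) + F.δ i F.U * d F.w := by
    simp [p, Derivation.leibniz]
  rw [this, derivation_w]
  simp only [P, sub_mul, Finset.sum_sub_distrib, ite_mul, one_mul, zero_mul, Finset.sum_ite_eq,
    Finset.mem_univ, if_true, mul_assoc, ← Finset.mul_sum]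
  rw [p]; ring

lemma S_eq (i j : ι) : F.S i j = ∑ k, F.P i k * F.h k j := F.derivation_p (F.δ j) i

/-- The symmetry of `S P`: since `S = P h` with `P` and `h` symmetric, `S P = P h P` is symmetric,
and `S P` has the entries `S_ij - (S p)_i p_j`. -/
lemma S_codazzi (i j : ι) : F.S i j - F.r i * F.p j = F.S j i - F.r j * F.p i := by
  have key (i j : ι) : F.S i j - F.r i * F.p j = ∑ k, ∑ l, F.P i k * F.h k l * F.P l j := by
    have : ∑ k, ∑ l, F.P i k * F.h k l * F.P l j = ∑ l, F.S i l * F.P l j := by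
      rw [Finset.sum_comm]
      exact Finset.sum_congr rfl fun l _ => by rw [S_eq, Finset.sum_mul]
    rw [this]
    simp only [P, mul_sub, Finset.sum_sub_distrib, mul_ite, mul_one, mul_zero, Finset.sum_ite_eq',
      Finset.mem_univ, if_true, ← mul_assoc, ← Finset.sum_mul, r]
  rw [key, key, Finset.sum_comm]
  exact Finset.sum_congr rfl fun k _ => Finset.sum_congr rfl fun l _ => by
    rw [F.h_symm k l, F.P_symm k j, F.P_symm i l]; ring

lemma sum_P_mul (φ : ι → A) (i : ι) : ∑ j, F.P i j * φ j = φ i - F.p i * ∑ j, F.p j * φ j := by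
  simp only [P, sub_mul, Finset.sum_sub_distrib, ite_mul, one_mul, zero_mul, Finset.sum_ite_eq,
    Finset.mem_univ, if_true, mul_assoc, ← Finset.mul_sum]

/-- The Laplace-Beltrami operator of the graph applied to the normal: the horizontal part of
`Δν = -∇H - |A|² ν`. It is the divergence of `S_codazzi`. -/
lemma laplace_p (k : ι) :
    ∑ i, ∑ j, F.P i j * F.δ i (F.δ j (F.p k)) - F.H * F.r k
      = (∑ i, F.P k i * F.δ i F.H) - F.q * F.p k := by
  have hr (j k : ι) : F.δ j (F.r k) = ∑ l, (F.δ j (F.S k l) * F.p l + F.S k l * F.S l j) := by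
    rw [r, map_sum]
    refine Finset.sum_congr rfl fun l _ => ?_
    simp only [Derivation.leibniz, smul_eq_mul, S]; ring
  have h1 : ∑ j, F.δ j (F.S k j - F.r k * F.p j) = ∑ j, F.δ j (F.S j k - F.r j * F.p k) :=
    Finset.sum_congr rfl fun j _ => by rw [S_codazzi]
  have hA : ∑ j, F.δ j (F.S k j - F.r k * F.p j)
      = ∑ j, F.δ j (F.S k j) - ∑ j, F.p j * F.δ j (F.r k) - F.r k * F.H := by
    rw [H, Finset.mul_sum, ← Finset.sum_sub_distrib, ← Finset.sum_sub_distrib]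
    refine Finset.sum_congr rfl fun j _ => ?_
    simp only [map_sub, Derivation.leibniz, smul_eq_mul, S]; ring
  have hB : ∑ j, F.δ j (F.S j k - F.r j * F.p k)
      = F.δ k F.H - (∑ j, F.δ j (F.r j)) * F.p k - ∑ j, F.S k j * F.r j := by
    rw [δ_H, Finset.sum_mul, ← Finset.sum_sub_distrib, ← Finset.sum_sub_distrib]
    refine Finset.sum_congr rfl fun j _ => ?_
    simp only [map_sub, Derivation.leibniz, smul_eq_mul, S]; ring
  have hC : ∑ j, F.p j * F.δ j (F.r k)
      = (∑ i, F.p i * ∑ j, F.p j * F.δ i (F.δ j (F.p k))) + ∑ j, F.S k j * F.r j := by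
    simp only [hr, Finset.sum_add_distrib, mul_add]
    congr 1
    · refine Finset.sum_congr rfl fun i _ => ?_
      rw [Finset.mul_sum, Finset.mul_sum]
      exact Finset.sum_congr rfl fun j _ => by rw [S]; ring
    · simp only [r, Finset.mul_sum]
      rw [Finset.sum_comm]
      exact Finset.sum_congr rfl fun _ _ => Finset.sum_congr rfl fun _ _ => by ring
  have hD : ∑ j, F.δ j (F.r j) = (∑ j, F.p j * F.δ j F.H) + F.q := by
    simp only [hr, Finset.sum_add_distrib, q]
    congr 1
    rw [Finset.sum_comm]
    refine Finset.sum_congr rfl fun l _ => ?_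
    rw [← Finset.sum_mul, ← δ_H, mul_comm]
  simp only [sum_P_mul]
  rw [Finset.sum_sub_distrib]
  have hE : ∑ i, F.δ i (F.δ i (F.p k)) = ∑ j, F.δ j (F.S k j) := rfl
  rw [hE]
  linear_combination h1 - hA + hB + hC - F.p k * hD

end FormalGraph

/-! ### The flow equation over an algebra with derivations -/

/-- The graphical flow `w ∂_t U = f` with `f = f(H)`; `f₁` and `f₂` play the roles of `f'(H)` and
`f''(H)`, characterized by the chain rule. -/
structure FormalFlow (ι A : Type*) [Fintype ι] [CommRing A] [Algebra ℝ A] extends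
    FormalGraph ι A where
  f : A
  f₁ : A
  f₂ : A
  flow : w * τ U = f
  δ_f : ∀ i, δ i f = f₁ * δ i toFormalGraph.H
  τ_f : τ f = f₁ * τ toFormalGraph.H
  δ_f₁ : ∀ i, δ i f₁ = f₂ * δ i toFormalGraph.H

namespace FormalFlow

open FormalGraph

variable {ι A : Type*} [Fintype ι] [DecidableEq ι] [CommRing A] [Algebra ℝ A]
  (F : FormalFlow ι A)

/-- In terms of the normal time derivative `D_t = τ - f p · ∇`, this reads `D_t p = ∇f`. -/
lemma τ_p (i : ι) : F.τ (F.p i) = (∑ k, F.P i k * F.δ k F.f) + F.f * F.r i := by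
  rw [derivation_p]
  have h1 (k : ι) : F.w * F.τ (F.δ k F.U) = F.δ k F.f + F.f * ∑ l, F.h k l * F.p l := by
    have h2 := congrArg (F.δ k) F.flow
    simp only [Derivation.leibniz, smul_eq_mul, F.derivation_w (F.δ k)] at h2
    have h3 : ∑ l, F.h k l * F.p l = ∑ l, F.p l * (F.w * F.δ k (F.δ l F.U)) :=
      Finset.sum_congr rfl fun l _ => by rw [F.h_symm, h]; ring
    rw [h3, F.τ_comm, ← h2]
    linear_combination (∑ l, F.p l * (F.w * F.δ k (F.δ l F.U))) * F.flow
  simp only [h1, mul_add, Finset.sum_add_distrib, r, S_eq, Finset.mul_sum, Finset.sum_mul]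
  congr 1
  rw [Finset.sum_comm]
  exact Finset.sum_congr rfl fun _ _ => Finset.sum_congr rfl fun _ _ => by ring

/-- The linearized operator `𝓛 = D_t - f' Δ`, where `D_t = τ - f p · ∇` is the time derivative along
the normal motion and `Δ = g^{ij} ∂_i ∂_j - H p · ∇` is the Laplace-Beltrami operator. -/
def L (φ : A) : A :=
  F.τ φ + (F.f₁ * F.H - F.f) * ∑ i, F.p i * F.δ i φ
    - F.f₁ * ∑ i, ∑ j, F.P i j * F.δ i (F.δ j φ)

/-- The inner product of the tangential gradients, `g^{ij} ∂_i φ ∂_j χ`. -/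
def Γ (φ χ : A) : A := ∑ i, ∑ j, F.P i j * F.δ i φ * F.δ j χ

end FormalFlow

namespace FormalFlow
open FormalGraph

variable {ι A : Type*} [Fintype ι] [DecidableEq ι] [CommRing A] [Algebra ℝ A]
  (F : FormalFlow ι A)

/-! ### Evolution equations -/

/-- The trace of `A³`. -/
def trS3 : A := ∑ k, ∑ m, F.S m k * ∑ i, F.S k i * F.S i m

/-- The term `⟨A, ∇H ⊗ ∇H⟩`. -/
def hHH : A := ∑ m, F.δ m F.H * ∑ k, F.S m k * ∑ i, F.P k i * F.δ i F.H

/-- The squared norm `|∇A|²` in the form in which it arises from `𝓛 |A|²`; see `R_eq`. -/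
def R : A := ∑ k, ∑ m, F.Γ (F.S k m) (F.S m k)
  + 2 * ∑ k, ∑ m, F.S m k * ∑ i, F.S i m * ∑ j, F.p j * F.δ i (F.S k j)
  - ∑ m, F.r m * F.δ m F.q

lemma Γ_comm (φ χ : A) : F.Γ φ χ = F.Γ χ φ := by
  rw [Γ, Γ, Finset.sum_comm]
  exact Finset.sum_congr rfl fun i _ => Finset.sum_congr rfl fun j _ => by
    rw [F.P_symm j i]; ring

lemma L_add (φ χ : A) : F.L (φ + χ) = F.L φ + F.L χ := by
  simp only [L, map_add, mul_add, Finset.sum_add_distrib]; ring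

/-- The operator `L` as an additive map. -/
def LHom : A →+ A where
  toFun := F.L
  map_zero' := by simp [L]
  map_add' := F.L_add

lemma L_sum {κ : Type*} (s : Finset κ) (φ : κ → A) : F.L (∑ k ∈ s, φ k) = ∑ k ∈ s, F.L (φ k) :=
  map_sum F.LHom φ s

lemma L_mul (φ χ : A) : F.L (φ * χ) = φ * F.L χ + χ * F.L φ - 2 * F.f₁ * F.Γ φ χ := by
  have h1 : ∑ i, ∑ j, F.P i j * F.δ i (F.δ j (φ * χ))
      = φ * (∑ i, ∑ j, F.P i j * F.δ i (F.δ j χ)) + χ * (∑ i, ∑ j, F.P i j * F.δ i (F.δ j φ))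
        + F.Γ φ χ + F.Γ χ φ := by
    simp only [Γ, Finset.mul_sum, ← Finset.sum_add_distrib]
    refine Finset.sum_congr rfl fun i _ => Finset.sum_congr rfl fun j _ => ?_
    simp only [Derivation.leibniz, smul_eq_mul, map_add]; ring
  have h2 : ∑ i, F.p i * F.δ i (φ * χ)
      = φ * (∑ i, F.p i * F.δ i χ) + χ * ∑ i, F.p i * F.δ i φ := by
    simp only [Finset.mul_sum, ← Finset.sum_add_distrib]
    refine Finset.sum_congr rfl fun i _ => ?_
    simp only [Derivation.leibniz, smul_eq_mul]; ring
  rw [F.Γ_comm χ φ] at h1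
  unfold L
  rw [h1, h2]
  simp only [Derivation.leibniz, smul_eq_mul]
  ring

lemma δ_P (m i j : ι) : F.δ m (F.P i j) = -(F.S i m * F.p j + F.p i * F.S j m) := by
  have : F.δ m (if i = j then (1 : A) else 0) = 0 := by split_ifs <;> simp
  simp only [P, map_sub, this, Derivation.leibniz, smul_eq_mul, S]; ring

/-- The commutator of `L` with a partial derivative. -/
lemma L_δ (m : ι) (φ : A) :
    F.L (F.δ m φ) = F.δ m (F.L φ) - F.f₂ * F.δ m F.H * F.H * (∑ i, F.p i * F.δ i φ)
      - (F.f₁ * F.H - F.f) * (∑ i, F.S i m * F.δ i φ)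
      + F.f₂ * F.δ m F.H * (∑ i, ∑ j, F.P i j * F.δ i (F.δ j φ))
      - 2 * F.f₁ * ∑ i, F.S i m * ∑ j, F.p j * F.δ i (F.δ j φ) := by
  have h1 : F.δ m (∑ i, ∑ j, F.P i j * F.δ i (F.δ j φ))
      = (∑ i, ∑ j, F.P i j * F.δ i (F.δ j (F.δ m φ)))
        - ∑ i, ∑ j, (F.S i m * (F.p j * F.δ i (F.δ j φ)) + F.p i * F.S j m * F.δ i (F.δ j φ)) := by
    simp only [map_sum, ← Finset.sum_sub_distrib]
    refine Finset.sum_congr rfl fun i _ => Finset.sum_congr rfl fun j _ => ?_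
    rw [F.δ_comm j m, F.δ_comm i m]
    simp only [Derivation.leibniz, smul_eq_mul, δ_P]; ring
  have h2 : ∑ i, ∑ j, F.p i * F.S j m * F.δ i (F.δ j φ)
      = ∑ i, F.S i m * ∑ j, F.p j * F.δ i (F.δ j φ) := by
    rw [Finset.sum_comm]
    refine Finset.sum_congr rfl fun i _ => ?_
    rw [Finset.mul_sum]
    exact Finset.sum_congr rfl fun j _ => by rw [F.δ_comm j i]; ring
  have h3 : F.δ m (∑ i, F.p i * F.δ i φ)
      = (∑ i, F.p i * F.δ i (F.δ m φ)) + ∑ i, F.S i m * F.δ i φ := by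
    simp only [map_sum, ← Finset.sum_add_distrib]
    refine Finset.sum_congr rfl fun i _ => ?_
    rw [F.δ_comm i m]
    simp only [Derivation.leibniz, smul_eq_mul, S]; ring
  simp only [Finset.sum_add_distrib, h2] at h1
  simp only [← Finset.mul_sum] at h1
  simp only [L, map_sub, map_add, Derivation.leibniz, smul_eq_mul, h1, h3, F.δ_f, F.δ_f₁,
    F.τ_comm]
  ring

/-- The normal satisfies the linearized equation `𝓛 p = f' |A|² p`. -/
lemma L_p (k : ι) : F.L (F.p k) = F.f₁ * F.q * F.p k := by
  have h1 := F.laplace_p k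
  have h2 : ∑ i, F.P k i * F.δ i F.f = F.f₁ * ∑ i, F.P k i * F.δ i F.H := by
    rw [Finset.mul_sum]
    exact Finset.sum_congr rfl fun i _ => by rw [F.δ_f]; ring
  have h3 : ∑ i, F.p i * F.δ i (F.p k) = F.r k :=
    Finset.sum_congr rfl fun i _ => by rw [S]; ring
  rw [L, τ_p, h2, h3]
  linear_combination -F.f₁ * h1

/-- The derivative of `L_p`; this is Simons' identity combined with the flow equation. -/
lemma L_S (k m : ι) :
    F.L (F.S k m) = F.f₂ * F.δ m F.H * (∑ i, F.P k i * F.δ i F.H) + F.f₁ * F.δ m F.q * F.p k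
      + F.f₁ * F.q * F.S k m + (F.f - F.f₁ * F.H) * (∑ i, F.S k i * F.S i m)
      - 2 * F.f₁ * ∑ i, F.S i m * ∑ j, F.p j * F.δ i (F.S k j) := by
  have h1 := F.laplace_p k
  have h3 : ∑ i, F.p i * F.δ i (F.p k) = F.r k :=
    Finset.sum_congr rfl fun i _ => by rw [S]; ring
  have h4 : ∑ i, F.S i m * F.δ i (F.p k) = ∑ i, F.S k i * F.S i m :=
    Finset.sum_congr rfl fun i _ => by rw [mul_comm]; rfl
  rw [S, L_δ, L_p, h3, h4]
  simp only [Derivation.leibniz, smul_eq_mul, F.δ_f₁, S] at h1 ⊢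
  linear_combination F.f₂ * F.δ m F.H * h1

omit [DecidableEq ι] in
lemma δ_q (m : ι) : F.δ m F.q = 2 * ∑ k, ∑ l, F.S l k * F.δ m (F.S k l) := by
  have : F.δ m F.q = (∑ k, ∑ l, F.S l k * F.δ m (F.S k l))
      + ∑ k, ∑ l, F.S k l * F.δ m (F.S l k) := by
    simp only [q, map_sum, Derivation.leibniz, smul_eq_mul, Finset.sum_add_distrib]
    rw [add_comm]
  rw [this, Finset.sum_comm (f := fun k l => F.S k l * F.δ m (F.S l k)), two_mul]

lemma L_q :
    F.L F.q = 2 * (F.f₂ * F.hHH + F.f₁ * F.q ^ 2 + (F.f - F.f₁ * F.H) * F.trS3 - F.f₁ * F.R) := by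
  have h1 : F.L F.q = 2 * (∑ k, ∑ m, F.S m k * F.L (F.S k m))
      - 2 * F.f₁ * ∑ k, ∑ m, F.Γ (F.S k m) (F.S m k) := by
    have : F.L F.q = (∑ k, ∑ m, F.S m k * F.L (F.S k m)) + (∑ k, ∑ m, F.S k m * F.L (F.S m k))
      - 2 * F.f₁ * ∑ k, ∑ m, F.Γ (F.S k m) (F.S m k) := by
      simp only [q, L_sum, L_mul, Finset.mul_sum, Finset.sum_add_distrib, Finset.sum_sub_distrib]
      ring
    rw [this, Finset.sum_comm (f := fun k m => F.S k m * F.L (F.S m k))]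
    ring
  have h2 : ∑ k, ∑ m, F.S m k * F.L (F.S k m)
      = F.f₂ * F.hHH + F.f₁ * (∑ m, F.r m * F.δ m F.q) + F.f₁ * F.q * F.q
        + (F.f - F.f₁ * F.H) * F.trS3
        - 2 * F.f₁ * ∑ k, ∑ m, F.S m k * ∑ i, F.S i m * ∑ j, F.p j * F.δ i (F.S k j) := by
    have e1 : F.hHH = ∑ k, ∑ m, F.S m k * (F.δ m F.H * ∑ i, F.P k i * F.δ i F.H) := by
      rw [hHH, Finset.sum_comm]
      refine Finset.sum_congr rfl fun m _ => ?_
      rw [Finset.mul_sum]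
      exact Finset.sum_congr rfl fun k _ => by ring
    have e2 : ∑ m, F.r m * F.δ m F.q = ∑ k, ∑ m, F.S m k * (F.δ m F.q * F.p k) := by
      rw [Finset.sum_comm]
      refine Finset.sum_congr rfl fun m _ => ?_
      rw [r, Finset.sum_mul]
      exact Finset.sum_congr rfl fun k _ => by ring
    have e3 : F.q = ∑ k, ∑ m, F.S m k * F.S k m :=
      Finset.sum_congr rfl fun k _ => Finset.sum_congr rfl fun m _ => by ring
    have e4 (k m : ι) : F.S m k * F.L (F.S k m)
        = F.f₂ * (F.S m k * (F.δ m F.H * ∑ i, F.P k i * F.δ i F.H))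
          + F.f₁ * (F.S m k * (F.δ m F.q * F.p k)) + F.f₁ * F.q * (F.S m k * F.S k m)
          + (F.f - F.f₁ * F.H) * (F.S m k * ∑ i, F.S k i * F.S i m)
          - 2 * F.f₁ * (F.S m k * ∑ i, F.S i m * ∑ j, F.p j * F.δ i (F.S k j)) := by
      rw [L_S]; ring
    simp only [e4, Finset.sum_add_distrib, Finset.sum_sub_distrib, ← Finset.mul_sum, ← e1, ← e2,
      ← e3]
    rfl
  rw [h1, h2, R]
  ring

/-- The trace of `L_S`. -/
lemma L_H : F.L F.H = F.f₂ * F.Γ F.H F.H + F.f * F.q := by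
  have h1 : ∑ k, F.δ k F.H * (∑ i, F.P k i * F.δ i F.H) = F.Γ F.H F.H := by
    simp only [Γ, Finset.mul_sum]
    exact Finset.sum_congr rfl fun _ _ => Finset.sum_congr rfl fun _ _ => by ring
  have h2 : ∑ k, F.δ k F.q * F.p k
      = 2 * ∑ k, ∑ i, F.S i k * ∑ j, F.p j * F.δ i (F.S k j) := by
    simp only [δ_q, Finset.mul_sum, Finset.sum_mul]
    rw [Finset.sum_comm]
    refine Finset.sum_congr rfl fun k _ => ?_
    rw [Finset.sum_comm]
    exact Finset.sum_congr rfl fun i _ => Finset.sum_congr rfl fun j _ => by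
      rw [F.δ_S_comm j i k]; ring
  have h3 : ∑ k, ∑ i, F.S k i * F.S i k = F.q := rfl
  have h4 : F.L F.H = ∑ k, F.L (F.S k k) := by rw [H, L_sum]
  have h5 (k : ι) : F.L (F.S k k)
      = F.f₂ * (F.δ k F.H * (∑ i, F.P k i * F.δ i F.H)) + F.f₁ * (F.δ k F.q * F.p k)
        + F.f₁ * F.q * F.S k k + (F.f - F.f₁ * F.H) * (∑ i, F.S k i * F.S i k)
        - 2 * F.f₁ * ∑ i, F.S i k * ∑ j, F.p j * F.δ i (F.S k j) := by
    rw [L_S]; ring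
  rw [h4]
  simp only [h5, Finset.sum_add_distrib, Finset.sum_sub_distrib, ← Finset.mul_sum, h1, h2, h3]
  rw [show ∑ k, F.S k k = F.H from rfl]
  ring

lemma L_f : F.L F.f = F.f₁ * F.f * F.q := by
  have h1 : ∑ i, ∑ j, F.P i j * F.δ i (F.δ j F.f)
      = F.f₁ * (∑ i, ∑ j, F.P i j * F.δ i (F.δ j F.H)) + F.f₂ * F.Γ F.H F.H := by
    simp only [Γ, Finset.mul_sum, ← Finset.sum_add_distrib]
    refine Finset.sum_congr rfl fun i _ => Finset.sum_congr rfl fun j _ => ?_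
    simp only [F.δ_f, F.δ_f₁, Derivation.leibniz, smul_eq_mul]; ring
  have h2 : ∑ i, F.p i * F.δ i F.f = F.f₁ * ∑ i, F.p i * F.δ i F.H := by
    rw [Finset.mul_sum]
    exact Finset.sum_congr rfl fun i _ => by rw [F.δ_f]; ring
  have h3 := F.L_H
  rw [L] at h3
  rw [L, h1, h2, F.τ_f]
  linear_combination F.f₁ * h3

omit [DecidableEq ι] in
lemma sum_p_sq : ∑ i, F.p i * F.p i = 1 - F.w * F.w := by
  have : ∑ i, F.p i * F.p i = F.w * F.w * ∑ i, F.δ i F.U * F.δ i F.U := by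
    rw [Finset.mul_sum]
    exact Finset.sum_congr rfl fun i _ => by rw [p]; ring
  rw [this]
  linear_combination F.w_sq

omit [DecidableEq ι] in
lemma w_cancel {x y : A} (hxy : F.w * x = F.w * y) : x = y := by
  linear_combination F.w * (1 + ∑ i, F.δ i F.U * F.δ i F.U) * hxy + (y - x) * F.w_sq

omit [DecidableEq ι] in
lemma w_mul_sum_p_δ_U : F.w * ∑ i, F.p i * F.δ i F.U = 1 - F.w * F.w := by
  rw [← sum_p_sq, Finset.mul_sum]
  exact Finset.sum_congr rfl fun i _ => by rw [p]; ring

lemma L_U : F.L F.U = (F.f - F.f₁ * F.H) * F.w := by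
  have h1 : F.w * ∑ i, ∑ j, F.P i j * F.δ i (F.δ j F.U) = F.H := by
    rw [H, Finset.mul_sum]
    refine Finset.sum_congr rfl fun i _ => ?_
    rw [S_eq, Finset.mul_sum]
    exact Finset.sum_congr rfl fun j _ => by rw [h]; ring
  apply F.w_cancel
  rw [L]
  linear_combination (F.f₁ * F.H - F.f) * F.w_mul_sum_p_δ_U - F.f₁ * h1 + F.flow

lemma Γ_U_U : F.Γ F.U F.U = 1 - F.w * F.w := by
  have h1 : F.Γ F.U F.U
      = (∑ i, F.δ i F.U * F.δ i F.U) - (∑ i, F.p i * F.δ i F.U) * ∑ i, F.p i * F.δ i F.U := by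
    have (i : ι) : ∑ j, F.P i j * F.δ i F.U * F.δ j F.U
        = F.δ i F.U * F.δ i F.U - (F.p i * F.δ i F.U) * ∑ j, F.p j * F.δ j F.U := by
      have := F.sum_P_mul (fun j => F.δ j F.U) i
      rw [show ∑ j, F.P i j * F.δ i F.U * F.δ j F.U = F.δ i F.U * ∑ j, F.P i j * F.δ j F.U by
        rw [Finset.mul_sum]; exact Finset.sum_congr rfl fun j _ => by ring, this]
      ring
    simp only [Γ, this, Finset.sum_sub_distrib, ← Finset.sum_mul]
  apply F.w_cancel
  apply F.w_cancel
  rw [h1]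
  linear_combination F.w_sq - (F.w * (∑ i, F.p i * F.δ i F.U) + 1 - F.w * F.w) * F.w_mul_sum_p_δ_U

end FormalFlow

namespace FormalFlow
open FormalGraph
open Matrix

variable {ι A : Type*} [Fintype ι] [DecidableEq ι] [CommRing A] [Algebra ℝ A]
  (F : FormalFlow ι A)

/-! ### The covariant derivative of the second fundamental form -/

/-- The matrix `h S`. -/
def y (i m : ι) : A := ∑ j, F.h i j * F.S j m

/-- The components `∇_i h^k_m` of the covariant derivative of the shape operator. -/
def B (i k m : ι) : A := F.δ i (F.S k m) + (F.p k * F.y i m - F.h i m * F.r k)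

/-- The vector `h p`. -/
def hp (k : ι) : A := ∑ l, F.h k l * F.p l

/-- The covariant derivative `∇_i h_km` with all indices down; the Christoffel symbols of a graph are
`Γ^k_ij = h_ij p_k`, without any derivative of the metric. -/
def b (i k m : ι) : A := F.δ i (F.h k m) - F.h k i * F.hp m - F.hp k * F.h m i

/-- The pairing `g^{ij} X_i^k_m Y_j^m_k` of tensors with one upper index `k` and two lower indices
`i`, `m`. -/
def E (X Y : ι → ι → ι → A) : A := ∑ i, ∑ j, F.P i j * ∑ k, ∑ m, X i k m * Y j m k

lemma sum_comm₄ {ι A : Type*} [Fintype ι] [AddCommMonoid A] (g : ι → ι → ι → ι → A) :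
    ∑ i, ∑ j, ∑ k, ∑ m, g i j k m = ∑ k, ∑ m, ∑ i, ∑ j, g i j k m := by
  simpa [Fintype.sum_prod_type] using Finset.sum_comm (s := (Finset.univ : Finset (ι × ι)))
    (t := (Finset.univ : Finset (ι × ι))) (f := fun x y => g x.1 x.2 y.1 y.2)

omit [DecidableEq ι] in
lemma b_symm (i k m : ι) : F.b i k m = F.b i m k := by
  rw [b, b, F.h_symm k m]; ring

lemma B_eq (i k m : ι) : F.B i k m = ∑ l, F.P k l * F.b i l m := by
  have h1 : F.δ i (F.S k m) = (∑ l, F.P k l * F.δ i (F.h l m)) - F.S k i * F.hp m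
      - F.p k * F.y i m := by
    have e2 : F.y i m = ∑ l, F.S l i * F.h l m := by
      simp only [y, S_eq, Finset.mul_sum, Finset.sum_mul]
      rw [Finset.sum_comm]
      exact Finset.sum_congr rfl fun _ _ => Finset.sum_congr rfl fun _ _ => by
        rw [F.P_symm, F.h_symm i]; ring
    rw [S_eq, map_sum, e2, hp, Finset.mul_sum, Finset.mul_sum, ← Finset.sum_sub_distrib,
      ← Finset.sum_sub_distrib]
    refine Finset.sum_congr rfl fun l _ => ?_
    simp only [Derivation.leibniz, smul_eq_mul, δ_P, F.h_symm m l]; ring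
  have h2 : F.r k = ∑ l, F.P k l * F.hp l := by
    simp only [r, hp, S_eq, Finset.mul_sum, Finset.sum_mul]
    rw [Finset.sum_comm]
    exact Finset.sum_congr rfl fun _ _ => Finset.sum_congr rfl fun _ _ => by ring
  rw [B, h1, h2, S_eq, F.h_symm i m]
  simp only [b, mul_sub, Finset.sum_sub_distrib, ← mul_assoc, ← Finset.sum_mul]
  ring

lemma E_add_left (X X' Y : ι → ι → ι → A) : F.E (X + X') Y = F.E X Y + F.E X' Y := by
  simp only [E, Pi.add_apply, add_mul, Finset.sum_add_distrib, mul_add]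

lemma E_comm (X Y : ι → ι → ι → A) : F.E X Y = F.E Y X := by
  rw [E, E, Finset.sum_comm]
  refine Finset.sum_congr rfl fun i _ => Finset.sum_congr rfl fun j _ => ?_
  rw [F.P_symm, Finset.sum_comm]
  congr 1
  exact Finset.sum_congr rfl fun _ _ => Finset.sum_congr rfl fun _ _ => by ring

lemma E_correction (X : ι → ι → ι → A) :
    F.E X (fun i k m => F.p k * F.y i m - F.h i m * F.r k)
      = ∑ i, ∑ k, ∑ m, X i k m * (F.p m * (∑ j, F.S i j * F.S j k) - F.S i k * F.r m) := by
  have e (i k : ι) : ∑ j, F.S i j * F.S j k = ∑ j, F.P i j * F.y j k := by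
    simp only [y, F.S_eq i, Finset.mul_sum, Finset.sum_mul]
    rw [Finset.sum_comm]
    exact Finset.sum_congr rfl fun _ _ => Finset.sum_congr rfl fun _ _ => by ring
  simp only [E, e]
  simp only [F.S_eq, Finset.mul_sum, Finset.sum_mul, ← Finset.sum_sub_distrib]
  refine Finset.sum_congr rfl fun i _ => ?_
  rw [Finset.sum_comm]
  refine Finset.sum_congr rfl fun k _ => ?_
  rw [Finset.sum_comm]
  refine Finset.sum_congr rfl fun m _ => Finset.sum_congr rfl fun j _ => ?_
  ring

/-- The Christoffel terms of `∇A` are a null vector for the pairing. -/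
lemma E_correction_self :
    F.E (fun i k m => F.p k * F.y i m - F.h i m * F.r k)
      (fun i k m => F.p k * F.y i m - F.h i m * F.r k) = 0 := by
  let hM : Matrix ι ι A := F.h
  let SM : Matrix ι ι A := F.S
  let PM : Matrix ι ι A := F.P
  have hT : hMᵀ = hM := by ext i j; exact F.h_symm j i
  have PT : PMᵀ = PM := by ext i j; exact F.P_symm j i
  have hS : SM = PM * hM := by ext i j; exact F.S_eq i j
  have hr : F.r = SM *ᵥ F.p := rfl
  have hy : (F.y : Matrix ι ι A) = hM * SM := rfl
  have h1 : F.E (fun i k m => F.p k * F.y i m - F.h i m * F.r k)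
      (fun i k m => F.p k * F.y i m - F.h i m * F.r k)
      = (hM * SM) *ᵥ F.p ⬝ᵥ (SM * SM) *ᵥ F.p - (hM * SM) *ᵥ F.r ⬝ᵥ SM *ᵥ F.p
        - (hM *ᵥ F.p ⬝ᵥ (SM * SM) *ᵥ F.r) + hM *ᵥ F.r ⬝ᵥ SM *ᵥ F.r := by
    rw [E_correction]
    simp only [dotProduct, ← Finset.sum_sub_distrib, ← Finset.sum_add_distrib]
    refine Finset.sum_congr rfl fun i _ => ?_
    simp only [mulVec, dotProduct, Finset.sum_mul_sum, ← Finset.sum_sub_distrib,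
      ← Finset.sum_add_distrib]
    rw [Finset.sum_comm]
    refine Finset.sum_congr rfl fun m _ => Finset.sum_congr rfl fun k _ => ?_
    have e1 : ∑ j, F.S i j * F.S j k = (SM * SM) i k := rfl
    have e2 : F.y i m = (hM * SM) i m := rfl
    rw [e1, e2]
    ring
  have key (M N : Matrix ι ι A) : M *ᵥ F.p ⬝ᵥ N *ᵥ F.p = F.p ⬝ᵥ (Mᵀ * N) *ᵥ F.p := by
    rw [← mulVec_mulVec, dotProduct_mulVec F.p, vecMul_transpose]
  rw [h1, hr, hS]
  simp only [mulVec_mulVec, key, transpose_mul, hT, PT, mul_assoc]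
  ring

/-- The term `R` is `|∇A|²`. -/
lemma R_eq : F.R = F.E F.B F.B := by
  have h1 : F.B = (fun i k m => F.δ i (F.S k m))
      + (fun i k m => F.p k * F.y i m - F.h i m * F.r k) := rfl
  have h2 : F.E F.B F.B = F.E (fun i k m => F.δ i (F.S k m)) (fun i k m => F.δ i (F.S k m))
      + 2 * F.E (fun i k m => F.δ i (F.S k m))
        (fun i k m => F.p k * F.y i m - F.h i m * F.r k) := by
    rw [h1, E_add_left, E_comm, E_add_left, E_comm (Y := _ + _), E_add_left, E_correction_self]
    rw [F.E_comm (fun i k m => F.p k * F.y i m - F.h i m * F.r k)]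
    ring
  have h3 : F.E (fun i k m => F.δ i (F.S k m)) (fun i k m => F.δ i (F.S k m))
      = ∑ k, ∑ m, F.Γ (F.S k m) (F.S m k) := by
    have (k m : ι) : F.Γ (F.S k m) (F.S m k)
      = ∑ i, ∑ j, F.P i j * (F.δ i (F.S k m) * F.δ j (F.S m k)) := by simp only [Γ, mul_assoc]
    simp only [E, Finset.mul_sum, this]
    exact sum_comm₄ _
  have h4 : ∑ m, F.r m * F.δ m F.q = 2 * ∑ i, ∑ k, ∑ m, F.δ i (F.S k m) * (F.S i k * F.r m) := by
    simp only [δ_q, Finset.mul_sum]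
    rw [Finset.sum_comm, Finset.sum_comm (f := fun i k => ∑ m, 2 * _)]
    refine Finset.sum_congr rfl fun k _ => ?_
    rw [Finset.sum_comm]
    exact Finset.sum_congr rfl fun i _ => Finset.sum_congr rfl fun m _ => by
      rw [F.δ_S_comm i m k]; ring
  rw [h2, h3, E_correction, R, h4]
  simp only [mul_sub, Finset.sum_sub_distrib]
  have h5 : ∑ k, ∑ m, F.S m k * ∑ i, F.S i m * ∑ j, F.p j * F.δ i (F.S k j)
    = ∑ i, ∑ k, ∑ m, F.δ i (F.S k m) * (F.p m * (∑ j, F.S i j * F.S j k)) := by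
    simp only [Finset.mul_sum]
    rw [Finset.sum_comm (f := fun i k => ∑ m, ∑ j, F.δ i (F.S k m) * _)]
    refine Finset.sum_congr rfl fun k _ => ?_
    rw [Finset.sum_comm]
    refine Finset.sum_congr rfl fun i _ => ?_
    rw [Finset.sum_comm]
    exact Finset.sum_congr rfl fun j _ => Finset.sum_congr rfl fun m _ => by ring
  rw [h5]; ring

end FormalFlow

/-! ### Inequalities for symmetric matrices -/

section MatrixInequalities

open Matrix

variable {ι : Type*} [Fintype ι]

lemma trace_mul_self_eq {X : Matrix ι ι ℝ} (hX : Xᵀ = X) : trace (X * X) = ∑ i, ∑ j, X i j ^ 2 := by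
  simp only [trace, diag, mul_apply]
  refine Finset.sum_congr rfl fun i _ => Finset.sum_congr rfl fun j _ => ?_
  rw [show X j i = X i j from congrFun (congrFun hX i) j, sq]

lemma sum_mul_sq_le (X Y : Matrix ι ι ℝ) :
    ∑ i, ∑ j, (X * Y) i j ^ 2 ≤ (∑ i, ∑ j, X i j ^ 2) * ∑ i, ∑ j, Y i j ^ 2 := by
  rw [Finset.sum_comm (f := fun i j => Y i j ^ 2), Finset.sum_mul_sum]
  refine Finset.sum_le_sum fun i _ => Finset.sum_le_sum fun j _ => ?_
  rw [mul_apply]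
  exact Finset.sum_mul_sq_le_sq_mul_sq _ _ _

lemma sq_trace_mul_le (X Y : Matrix ι ι ℝ) :
    trace (X * Y) ^ 2 ≤ (∑ i, ∑ j, X i j ^ 2) * ∑ i, ∑ j, Y i j ^ 2 := by
  rw [Finset.sum_comm (f := fun i j => Y i j ^ 2)]
  simp only [trace, diag, mul_apply, ← Finset.sum_product']
  exact Finset.sum_mul_sq_le_sq_mul_sq _ (fun x : ι × ι => X x.1 x.2) (fun x => Y x.2 x.1)

lemma sq_trace_cube_le {X : Matrix ι ι ℝ} (hX : Xᵀ = X) :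
    trace (X * (X * X)) ^ 2 ≤ trace (X * X) ^ 3 := by
  rw [trace_mul_self_eq hX]
  have h0 : 0 ≤ ∑ i, ∑ j, X i j ^ 2 :=
    Finset.sum_nonneg fun _ _ => Finset.sum_nonneg fun _ _ => sq_nonneg _
  calc _ ≤ _ := sq_trace_mul_le _ _
    _ ≤ _ := mul_le_mul_of_nonneg_left (sum_mul_sq_le X X) h0
    _ = _ := by ring

lemma sq_quadratic_le (X : Matrix ι ι ℝ) (η : ι → ℝ) :
    (η ⬝ᵥ X *ᵥ η) ^ 2 ≤ (∑ i, ∑ j, X i j ^ 2) * (η ⬝ᵥ η) ^ 2 := by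
  have h1 : (η ⬝ᵥ X *ᵥ η) ^ 2 ≤ (∑ i, η i ^ 2) * ∑ i, (X *ᵥ η) i ^ 2 :=
    Finset.sum_mul_sq_le_sq_mul_sq _ _ _
  have h2 : ∑ i, (X *ᵥ η) i ^ 2 ≤ (∑ i, ∑ j, X i j ^ 2) * ∑ i, η i ^ 2 := by
    rw [Finset.sum_mul]
    exact Finset.sum_le_sum fun i _ => Finset.sum_mul_sq_le_sq_mul_sq _ _ _
  have h3 : η ⬝ᵥ η = ∑ i, η i ^ 2 := Finset.sum_congr rfl fun i _ => (sq _).symm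
  have h0 : 0 ≤ ∑ i, η i ^ 2 := Finset.sum_nonneg fun _ _ => sq_nonneg _
  rw [h3]
  calc _ ≤ _ := h1
    _ ≤ _ := mul_le_mul_of_nonneg_left h2 h0
    _ = _ := by ring

lemma transpose_conj {h : Matrix ι ι ℝ} (hh : hᵀ = h) (L : Matrix ι ι ℝ) :
    (Lᵀ * h * L)ᵀ = Lᵀ * h * L := by
  simp [transpose_mul, hh, mul_assoc]

variable [DecidableEq ι]

/-- The factor is `1 - p pᵀ / (1 + |o|)`, the symmetric square root of `1 - p pᵀ`. -/
lemma exists_mul_transpose_eq (p : ι → ℝ) (o : ℝ) (h0 : o ≠ 0)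
    (hp : ∑ i, p i * p i = 1 - o * o) :
    ∃ L : Matrix ι ι ℝ, L * Lᵀ = 1 - vecMulVec p p := by
  have hp' : p ⬝ᵥ p = 1 - |o| * |o| := by rw [abs_mul_abs_self]; exact hp
  have h1 : (1 + |o|) ≠ 0 := by positivity
  refine ⟨1 - (1 + |o|)⁻¹ • vecMulVec p p, ?_⟩
  have ht : (vecMulVec p p)ᵀ = vecMulVec p p := transpose_vecMulVec _ _
  have hm : vecMulVec p p * vecMulVec p p = (1 - |o| * |o|) • vecMulVec p p := by
    rw [vecMulVec_mul_vecMulVec, hp', vecMulVec_smul]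
  -- the scalar identity behind `(1 - k p pᵀ)² = 1 - p pᵀ`, where `|p|² = 1 - o²`
  have hk : (1 + |o|)⁻¹ * 2 - (1 + |o|)⁻¹ * (1 + |o|)⁻¹ * (1 - |o| * |o|) = 1 := by
    field_simp
    ring
  simp only [transpose_sub, transpose_one, transpose_smul, ht, sub_mul, mul_sub, one_mul, mul_one,
    smul_mul_assoc, mul_smul_comm, hm]
  ext i j
  simp only [Matrix.sub_apply, Matrix.smul_apply, smul_eq_mul]
  linear_combination -(vecMulVec p p i j) * hk

end MatrixInequalities

namespace FormalFlow
open FormalGraph Matrix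

variable {ι A : Type*} [Fintype ι] [DecidableEq ι] [CommRing A] [Algebra ℝ A]
  (F : FormalFlow ι A)

/-! ### Evaluation at a point and Kato's inequality -/

omit [DecidableEq ι] in
/-- `|A|²` may be differentiated covariantly. -/
lemma trace_S_B (j : ι) : 2 * ∑ k, ∑ m, F.S k m * F.B j m k = F.δ j F.q := by
  have e1 : ∑ k, F.r k * F.y j k = ∑ m, F.r m * F.y j m := rfl
  have h1 : ∑ k, ∑ m, F.S k m * (F.p m * F.y j k) = ∑ k, F.r k * F.y j k := by
    refine Finset.sum_congr rfl fun k _ => ?_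
    rw [r, Finset.sum_mul]
    exact Finset.sum_congr rfl fun m _ => by ring
  have h2 : ∑ k, ∑ m, F.S k m * (F.h j k * F.r m) = ∑ m, F.r m * F.y j m := by
    rw [Finset.sum_comm]
    refine Finset.sum_congr rfl fun m _ => ?_
    rw [y, Finset.mul_sum]
    exact Finset.sum_congr rfl fun m _ => by ring
  rw [δ_q, Finset.sum_comm (f := fun k l => F.S l k * _)]
  simp only [B, mul_add, mul_sub, Finset.sum_add_distrib, Finset.sum_sub_distrib, h1, h2]
  rw [sub_self, add_zero]

variable (ev : A →ₐ[ℝ] ℝ)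

/-- The inverse metric at a point. -/
def PR : Matrix ι ι ℝ := Matrix.of fun i j => ev (F.P i j)

/-- The second fundamental form at a point. -/
def hR : Matrix ι ι ℝ := Matrix.of fun i j => ev (F.h i j)

/-- An orthonormal frame of the tangent space: the columns of `L` are orthonormal for the metric whose
inverse is `PR`. -/
lemma exists_frame : ∃ L : Matrix ι ι ℝ, F.PR ev = L * Lᵀ := by
  have h0 : ev F.w ≠ 0 := by
    intro h
    have := congrArg ev F.w_sq
    simp [h] at this
  obtain ⟨L, hL⟩ := exists_mul_transpose_eq (fun i => ev (F.p i)) (ev F.w) h0 (by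
    have := congrArg ev F.sum_p_sq
    simpa using this)
  refine ⟨L, ?_⟩
  rw [hL]
  ext i j
  simp only [PR, P, of_apply, map_sub, map_mul, Matrix.sub_apply, vecMulVec_apply, one_apply]
  split_ifs <;> simp

omit [DecidableEq ι] in
lemma hR_transpose : (F.hR ev)ᵀ = F.hR ev := by
  ext i j; simp only [hR, transpose_apply, of_apply, F.h_symm]

lemma ev_S (i j : ι) : ev (F.S i j) = (F.PR ev * F.hR ev) i j := by
  simp [S_eq, mul_apply, PR, hR]

lemma ev_q : ev F.q = trace ((F.PR ev * F.hR ev) * (F.PR ev * F.hR ev)) := by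
  simp only [q, map_sum, map_mul, ev_S, trace, diag, mul_apply (M := F.PR ev * F.hR ev)]

lemma ev_trS3 : ev F.trS3
    = trace ((F.PR ev * F.hR ev) * ((F.PR ev * F.hR ev) * (F.PR ev * F.hR ev))) := by
  rw [trS3, Finset.sum_comm]
  simp only [map_sum, map_mul, ev_S, trace, diag, mul_apply (M := F.PR ev * F.hR ev)]

lemma ev_q_frame {L : Matrix ι ι ℝ} (hL : F.PR ev = L * Lᵀ) :
    ev F.q = trace ((Lᵀ * F.hR ev * L) * (Lᵀ * F.hR ev * L)) := by
  rw [ev_q, hL, mul_assoc L, mul_assoc L, trace_mul_comm L]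
  simp only [mul_assoc]

lemma ev_trS3_sq_le : ev F.trS3 ^ 2 ≤ ev F.q ^ 3 := by
  obtain ⟨L, hL⟩ := F.exists_frame ev
  have h1 : ev F.trS3 = trace ((Lᵀ * F.hR ev * L) * ((Lᵀ * F.hR ev * L) * (Lᵀ * F.hR ev * L))) := by
    rw [ev_trS3, hL, mul_assoc L, mul_assoc L, trace_mul_comm L]
    simp only [mul_assoc]
  rw [h1, F.ev_q_frame ev hL]
  exact sq_trace_cube_le (transpose_conj (F.hR_transpose ev) L)

lemma ev_hHH_sq_le : ev F.hHH ^ 2 ≤ ev F.q * ev (F.Γ F.H F.H) ^ 2 := by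
  obtain ⟨L, hL⟩ := F.exists_frame ev
  set g : ι → ℝ := fun i => ev (F.δ i F.H) with hg
  have h1 : ev F.hHH = g ⬝ᵥ (F.PR ev * F.hR ev) *ᵥ (F.PR ev *ᵥ g) := by
    simp only [hHH, map_sum, map_mul, ev_S, dotProduct, mulVec, hg]
    rfl
  have h2 : ev (F.Γ F.H F.H) = g ⬝ᵥ F.PR ev *ᵥ g := by
    simp only [Γ, map_sum, map_mul, dotProduct, mulVec, hg, Finset.mul_sum]
    exact Finset.sum_congr rfl fun i _ => Finset.sum_congr rfl fun j _ => by simp [PR]; ring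
  have key (N : Matrix ι ι ℝ) : g ⬝ᵥ (L * N) *ᵥ g = (Lᵀ *ᵥ g) ⬝ᵥ N *ᵥ g := by
    rw [← mulVec_mulVec, dotProduct_mulVec, ← mulVec_transpose]
  have h3 : ev F.hHH = (Lᵀ *ᵥ g) ⬝ᵥ (Lᵀ * F.hR ev * L) *ᵥ (Lᵀ *ᵥ g) := by
    rw [h1, hL, mulVec_mulVec, mulVec_mulVec, ← key]
    simp only [mul_assoc]
  have h4 : ev (F.Γ F.H F.H) = (Lᵀ *ᵥ g) ⬝ᵥ (Lᵀ *ᵥ g) := by rw [h2, hL, key]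
  rw [h3, h4, F.ev_q_frame ev hL, trace_mul_self_eq (transpose_conj (F.hR_transpose ev) L)]
  exact sq_quadratic_le _ _

/-- The inner product of covectors at a point. -/
def ΓR (a b : ι → ℝ) : ℝ := ∑ i, ∑ j, ev (F.P i j) * a i * b j

lemma ev_Γ (φ χ : A) :
    ev (F.Γ φ χ) = F.ΓR ev (fun i => ev (F.δ i φ)) (fun i => ev (F.δ i χ)) := by
  simp [Γ, ΓR]

lemma ev_P_eq {L : Matrix ι ι ℝ} (hL : F.PR ev = L * Lᵀ) (i j : ι) :
    ev (F.P i j) = ∑ a, L i a * L j a := congrFun (congrFun hL i) j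

lemma sum_P_mul_frame {L : Matrix ι ι ℝ} (hL : F.PR ev = L * Lᵀ) (t : ι → ι → ℝ) :
    ∑ i, ∑ j, ev (F.P i j) * t i j = ∑ a, ∑ i, ∑ j, L i a * L j a * t i j := by
  simp only [F.ev_P_eq ev hL, Finset.sum_mul]
  rw [Finset.sum_comm]
  conv_rhs => rw [Finset.sum_comm]
  rw [Finset.sum_comm]
  exact Finset.sum_congr rfl fun i _ => Finset.sum_comm

lemma ΓR_self_nonneg (a : ι → ℝ) : 0 ≤ F.ΓR ev a a := by
  obtain ⟨L, hL⟩ := F.exists_frame ev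
  have : F.ΓR ev a a = ∑ c, (∑ i, L i c * a i) * ∑ i, L i c * a i := by
    simp only [ΓR, mul_assoc, F.sum_P_mul_frame ev hL, Finset.sum_mul_sum]
    exact Finset.sum_congr rfl fun c _ => Finset.sum_congr rfl fun i _ =>
      Finset.sum_congr rfl fun j _ => by ring
  rw [this]
  exact Finset.sum_nonneg fun c _ => mul_self_nonneg _

/-- A tensor that is symmetric in its last two indices has nonnegative square norm. In an orthonormal
frame the norm is a sum of squares. -/
lemma sum_P_trace_nonneg (c : ι → Matrix ι ι ℝ) (hc : ∀ i, (c i)ᵀ = c i) :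
    0 ≤ ∑ i, ∑ j, ev (F.P i j) * trace ((F.PR ev * c i) * (F.PR ev * c j)) := by
  obtain ⟨L, hL⟩ := F.exists_frame ev
  have h1 : ∑ i, ∑ j, ev (F.P i j) * trace ((F.PR ev * c i) * (F.PR ev * c j))
      = ∑ a, trace ((F.PR ev * ∑ i, L i a • c i) * (F.PR ev * ∑ i, L i a • c i)) := by
    rw [F.sum_P_mul_frame ev hL]
    refine Finset.sum_congr rfl fun a _ => ?_
    rw [Finset.mul_sum, Finset.sum_mul_sum]
    simp only [trace_sum, mul_smul_comm, smul_mul_assoc, trace_smul, smul_eq_mul]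
    exact Finset.sum_congr rfl fun i _ => Finset.sum_congr rfl fun j _ => by ring
  rw [h1]
  refine Finset.sum_nonneg fun a _ => ?_
  set d := ∑ i, L i a • c i
  have hd : dᵀ = d := by simp [d, transpose_sum, hc]
  have : trace ((F.PR ev * d) * (F.PR ev * d)) = trace ((Lᵀ * d * L) * (Lᵀ * d * L)) := by
    rw [hL, mul_assoc L, mul_assoc L, trace_mul_comm L]
    simp only [mul_assoc]
  rw [this, trace_mul_self_eq (transpose_conj hd L)]
  exact Finset.sum_nonneg fun _ _ => Finset.sum_nonneg fun _ _ => sq_nonneg _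

/-- Kato's inequality `|A|² |λ|² ≤ |∇A|²` for `λ = ∇ log |A|`. It expresses that
`∇A - λ ⊗ A` has nonnegative square norm. -/
lemma kato (lam : ι → ℝ) (hlam : ∀ i, ev (F.δ i F.q) = 2 * (ev F.q * lam i)) :
    ev F.q * F.ΓR ev lam lam ≤ ev F.R := by
  have h0 := F.sum_P_trace_nonneg ev
    (fun i => Matrix.of (fun k m => ev (F.b i k m)) - lam i • F.hR ev) (fun i => by
      rw [transpose_sub, transpose_smul, hR_transpose]
      congr 1
      ext k m
      simp only [transpose_apply, of_apply, F.b_symm i m k])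
  have h1 (i : ι) : F.PR ev * (Matrix.of (fun k m => ev (F.b i k m)) - lam i • F.hR ev)
      = Matrix.of (fun k m => ev (F.B i k m)) - lam i • Matrix.of (fun k m => ev (F.S k m)) := by
    ext k m
    simp only [mul_sub, mul_smul_comm, Matrix.sub_apply, Matrix.smul_apply, ← ev_S, of_apply, B_eq, map_sum,
      map_mul]
    rfl
  have h2 (j : ι) : ∑ k, ∑ m, ev (F.S k m) * ev (F.B j m k) = ev F.q * lam j := by
    have := congrArg ev (F.trace_S_B j)
    rw [hlam] at this
    simp only [map_mul, map_sum, map_ofNat] at this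
    linarith
  have h2' (j : ι) : ∑ k, ∑ m, ev (F.B j k m) * ev (F.S m k) = ev F.q * lam j := by
    rw [← h2, Finset.sum_comm]
    exact Finset.sum_congr rfl fun _ _ => Finset.sum_congr rfl fun _ _ => mul_comm _ _
  have h3 (i j : ι) : trace ((Matrix.of (fun k m => ev (F.B i k m)) -
        lam i • Matrix.of (fun k m => ev (F.S k m))) * (Matrix.of (fun k m => ev (F.B j k m)) -
        lam j • Matrix.of (fun k m => ev (F.S k m))))
      = (∑ k, ∑ m, ev (F.B i k m) * ev (F.B j m k)) - lam j * (ev F.q * lam i)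
        - lam i * (ev F.q * lam j) + lam i * lam j * ev F.q := by
    rw [← h2' i, ← h2 j]
    simp only [q, map_sum, map_mul, trace, diag, mul_apply, Matrix.sub_apply, of_apply, Matrix.smul_apply,
      smul_eq_mul, Finset.mul_sum, ← Finset.sum_sub_distrib, ← Finset.sum_add_distrib]
    exact Finset.sum_congr rfl fun _ _ => Finset.sum_congr rfl fun _ _ => by ring
  simp only [h1, h3] at h0
  have h4 : ev F.R = ∑ i, ∑ j, ev (F.P i j) * ∑ k, ∑ m, ev (F.B i k m) * ev (F.B j m k) := by
    rw [R_eq]; simp [E]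
  rw [h4, ← sub_nonneg]
  convert h0 using 1
  simp only [ΓR, Finset.mul_sum (a := ev F.q), ← Finset.sum_sub_distrib]
  exact Finset.sum_congr rfl fun _ _ => Finset.sum_congr rfl fun _ _ => by ring

end FormalFlow

/-! ### The threshold and the scalar inequality at a maximum point -/

/-- A bound for `ψ|A|` at an interior maximum of `ψ|A|/χ`. The quantities `|α - 1| (2/c)^{1/α} / (4α²c²)`
and `|α - 1| (2/c)^{1/α} / α` bound the coefficients `|f''|/f'³` and `|f/f' - H|`, since
`H ≤ (2/c)^{1/α}`. -/
noncomputable def threshold (α c a : ℝ) : ℝ :=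
  1 + 16 * (|α - 1| * (2 / c) ^ (1 / α) / (4 * α ^ 2 * c ^ 2)) * |a| / c ^ 4
    + 4 * (2 * (|α - 1| * (2 / c) ^ (1 / α) / α) * |a| + 2 + 64 / c ^ 6) / c ^ 2

lemma one_le_threshold {α c a : ℝ} (hα : 0 < α) (hc : 0 < c) : 1 ≤ threshold α c a := by
  unfold threshold
  have : 0 ≤ (2 / c) ^ (1 / α) := by positivity
  have h1 : 0 ≤ 16 * (|α - 1| * (2 / c) ^ (1 / α) / (4 * α ^ 2 * c ^ 2)) * |a| / c ^ 4 := by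
    positivity
  have h2 : 0 ≤ 4 * (2 * (|α - 1| * (2 / c) ^ (1 / α) / α) * |a| + 2 + 64 / c ^ 6) / c ^ 2 := by
    positivity
  linarith

/-- The weight `χ(f) = f - c - μ f²` with `μ = c³/8`. On the range `[2c, 2/c]` of the speed it is
positive and increasing, and the choice of `μ` is small enough for `f χ' - χ = c - μ f² ≥ c/2`. -/
noncomputable def speedWeight (c f : ℝ) : ℝ := f - c - c ^ 3 / 8 * f ^ 2

lemma speedWeight_bounds {c f : ℝ} (hc : 0 < c) (hf₁ : 2 * c ≤ f) (hf₂ : f ≤ 2 / c) :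
    c / 2 ≤ speedWeight c f ∧ speedWeight c f ≤ 2 / c ∧
      speedWeight c f + c / 2 ≤ f * (1 - 2 * (c ^ 3 / 8) * f) ∧
      0 ≤ 1 - 2 * (c ^ 3 / 8) * f ∧ 1 - 2 * (c ^ 3 / 8) * f ≤ 1 := by
  have hfc : f * c ≤ 2 := by rwa [le_div_iff₀ hc] at hf₂
  have hc1 : c ^ 2 ≤ 1 := by nlinarith
  have hf0 : 0 < f := by linarith
  have h1 : c ^ 3 / 8 * f ≤ c ^ 2 / 4 := by nlinarith [sq_nonneg c, mul_pos hc hc]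
  have h2 : c ^ 3 / 8 * f ^ 2 ≤ c / 2 := by
    have : (f * c) ^ 2 ≤ 4 := by nlinarith [mul_pos hf0 hc]
    nlinarith
  have h3 : 0 ≤ c ^ 3 / 8 * f := by positivity
  have h4 : c ^ 3 / 8 * f ^ 2 = (c ^ 3 / 8 * f) * f := by ring
  refine ⟨?_, ?_, ?_, ?_, ?_⟩
  · unfold speedWeight; nlinarith
  · unfold speedWeight; nlinarith [mul_nonneg h3 hf0.le]
  · unfold speedWeight; nlinarith
  · nlinarith
  · nlinarith

/-- The absorption argument. If `ψ y` exceeds the threshold, then `1/ψ` and `1/y` are small compared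
with `y` and `1`, and the two negative terms dominate all others. -/
lemma le_threshold_of_nonneg {α c a y ψ X : ℝ} (hα : 0 < α) (hc : 0 < c) (hy : 0 < y) (hψ : 0 < ψ)
    (hψa : ψ ≤ a) (hX0 : 0 ≤ X)
    (hfin : 0 ≤ |α - 1| * (2 / c) ^ (1 / α) / (4 * α ^ 2 * c ^ 2) * X / y
      + |α - 1| * (2 / c) ^ (1 / α) / α * y + |α - 1| * (2 / c) ^ (1 / α) / α / ψ
      + (c ^ 4 / 16 * X + 64 / c ^ 6 / ψ ^ 2)
      + 2 / ψ ^ 2 - c ^ 2 / 4 * y ^ 2 - c ^ 4 / 8 * X) :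
    ψ * y ≤ threshold α c a := by
  have hHm0 : 0 ≤ (2 / c) ^ (1 / α) := by positivity
  have hK₁0 : 0 ≤ |α - 1| * (2 / c) ^ (1 / α) / (4 * α ^ 2 * c ^ 2) := by positivity
  have hK₂0 : 0 ≤ |α - 1| * (2 / c) ^ (1 / α) / α := by positivity
  have ha : 0 < a := hψ.trans_le hψa
  have hth : threshold α c a = 1 + 16 * (|α - 1| * (2 / c) ^ (1 / α) / (4 * α ^ 2 * c ^ 2)) * a
      / c ^ 4 + 4 * (2 * (|α - 1| * (2 / c) ^ (1 / α) / α) * a + 2 + 64 / c ^ 6) / c ^ 2 := by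
    rw [threshold, abs_of_pos ha]
  rw [hth]
  generalize |α - 1| * (2 / c) ^ (1 / α) / (4 * α ^ 2 * c ^ 2) = K₁ at *
  generalize |α - 1| * (2 / c) ^ (1 / α) / α = K₂ at *
  by_contra! hN
  set N := ψ * y with hNdef
  have c1 : 0 ≤ 16 * K₁ * a / c ^ 4 := by positivity
  have c2 : 0 ≤ 4 * (2 * K₂ * a + 2 + 64 / c ^ 6) / c ^ 2 := by positivity
  have hN1 : 1 ≤ N := by linarith
  have hyN : N ≤ a * y := by rw [hNdef]; gcongr
  have g1 : K₁ / y ≤ c ^ 4 / 16 := by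
    rw [div_le_iff₀ hy]
    have h1 : 16 * K₁ * a / c ^ 4 ≤ a * y := by linarith
    rw [div_le_iff₀ (by positivity)] at h1
    have h2 : a * (K₁ * 16) ≤ a * (y * c ^ 4) := by linarith
    have := le_of_mul_le_mul_left h2 ha
    linarith
  have g2 : K₁ * X / y ≤ c ^ 4 / 16 * X := by
    rw [mul_div_right_comm]; gcongr
  have hs : 1 / ψ = y / N := by rw [hNdef]; field_simp
  have g3 : (2 * K₂ * a + 2 + 64 / c ^ 6) / N < c ^ 2 / 4 := by
    have h1 : 4 * (2 * K₂ * a + 2 + 64 / c ^ 6) / c ^ 2 < N := by linarith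
    rw [div_lt_iff₀ (by positivity)] at h1 ⊢
    linarith
  have hN0 : 0 < N := by linarith
  have g4 : 1 / y ≤ a / N := by rw [div_le_div_iff₀ hy hN0]; linarith
  have g5 : K₂ * y ≤ y ^ 2 * (K₂ * a / N) := by
    have : K₂ * y = y ^ 2 * (K₂ * (1 / y)) := by field_simp
    rw [this, mul_div_assoc]; gcongr
  have g6 : K₂ / ψ ≤ y ^ 2 * (K₂ * a / N) := by
    have h1 : K₂ / ψ = K₂ * y * (1 / N) := by
      rw [div_eq_mul_one_div, hs]; ring
    have h2 : 1 / N ≤ 1 := by rw [div_le_one hN0]; exact hN1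
    calc K₂ / ψ = K₂ * y * (1 / N) := h1
      _ ≤ K₂ * y * 1 := by gcongr
      _ = K₂ * y := mul_one _
      _ ≤ _ := g5
  have g7 : 64 / c ^ 6 / ψ ^ 2 + 2 / ψ ^ 2 ≤ y ^ 2 * ((2 + 64 / c ^ 6) / N) := by
    have h1 : 1 / ψ ^ 2 = y ^ 2 * (1 / N ^ 2) := by
      rw [← one_div_pow, hs]; ring
    have h2 : 1 / N ^ 2 ≤ 1 / N := by
      exact one_div_le_one_div_of_le hN0 (le_self_pow₀ hN1 two_ne_zero)
    calc _ = (2 + 64 / c ^ 6) * (1 / ψ ^ 2) := by ring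
      _ = (2 + 64 / c ^ 6) * (y ^ 2 * (1 / N ^ 2)) := by rw [h1]
      _ ≤ (2 + 64 / c ^ 6) * (y ^ 2 * (1 / N)) := by gcongr
      _ = _ := by ring
  have g8 : y ^ 2 * (K₂ * a / N) + y ^ 2 * (K₂ * a / N) + y ^ 2 * ((2 + 64 / c ^ 6) / N)
      < y ^ 2 * (c ^ 2 / 4) := by
    have : y ^ 2 * (K₂ * a / N) + y ^ 2 * (K₂ * a / N) + y ^ 2 * ((2 + 64 / c ^ 6) / N)
      = y ^ 2 * ((2 * K₂ * a + 2 + 64 / c ^ 6) / N) := by ring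
    rw [this]
    gcongr
  linarith

set_option maxHeartbeats 800000 in
/-- The inequality `hmain` is `𝓛 J ≥ 0` at a maximum point, see `FormalFlow.ev_curvature_le`. Here
`y = |A|`, `t = tr A³`, `k = ⟨A, ∇H ⊗ ∇H⟩`, `X = |∇f|²`, `XH = |∇H|²`, `G = |∇ψ|²` and
`Z = -⟨∇f, ∇ψ⟩`. -/
lemma curvature_le_threshold {α c a f H f₁ f₂ y t k w ψ X Z G XH : ℝ} (hα : 0 < α) (hc : 0 < c)
    (hf₁ : 2 * c ≤ f) (hf₂ : f ≤ 2 / c) (hH : 0 < H) (hHm : H ≤ (2 / c) ^ (1 / α))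
    (hf₁H : f₁ * H = α * f) (hf₂H : f₂ * H = (α - 1) * f₁) (hy : 0 < y)
    (ht : |t| ≤ y ^ 3) (hk : |k| ≤ y * XH) (hX : X = f₁ ^ 2 * XH) (hX0 : 0 ≤ X)
    (hw : |w| ≤ 1) (hψ : 0 < ψ) (hψa : ψ ≤ a) (hG : G ≤ 1) (hZ : Z ^ 2 ≤ X * G)
    (hmain : 0 ≤ f₂ * k + f₁ * y ^ 4 + (f - f₁ * H) * t - y ^ 2 * ((f - f₁ * H) * w) / ψ
      + f₁ * y ^ 2 * (2 * (1 - 2 * (c ^ 3 / 8) * f) * Z / (speedWeight c f * ψ) + 2 * G / ψ ^ 2)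
      - y ^ 2 / speedWeight c f * f₁
        * ((1 - 2 * (c ^ 3 / 8) * f) * f * y ^ 2 + 2 * (c ^ 3 / 8) * X)) :
    ψ * y ≤ threshold α c a := by
  obtain ⟨b1, b2, b3, b4, b5⟩ := speedWeight_bounds hc hf₁ hf₂
  set χ := speedWeight c f
  set χ' := 1 - 2 * (c ^ 3 / 8) * f
  set Hm := (2 / c) ^ (1 / α)
  set K₁ := |α - 1| * Hm / (4 * α ^ 2 * c ^ 2) with hK₁
  set K₂ := |α - 1| * Hm / α with hK₂
  have hf0 : 0 < f := by linarith
  have hχ : 0 < χ := by linarith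
  have hf1e : f₁ = α * f / H := by rw [eq_div_iff hH.ne', hf₁H]
  have hf1 : 0 < f₁ := by rw [hf1e]; positivity
  have hf2e : f₂ = (α - 1) * f₁ / H := by rw [eq_div_iff hH.ne', hf₂H]
  have hd : f - f₁ * H = f₁ * ((1 - α) * H / α) := by rw [hf1e]; field_simp
  have hHm0 : 0 < Hm := hH.trans_le hHm
  have hXHe : XH = X / f₁ ^ 2 := by rw [hX]; field_simp
  have hK₁0 : 0 ≤ K₁ := by positivity
  have hK₂0 : 0 ≤ K₂ := by positivity
  have ha : 0 < a := hψ.trans_le hψa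
  -- each term of the inequality, divided by `f₁ * y ^ 2`
  have e1 : f₂ * k ≤ f₁ * y ^ 2 * (K₁ * X / y) := by
    have h1 : f₂ * k ≤ |f₂| * |k| := by rw [← abs_mul]; exact le_abs_self _
    have h2 : |f₂| = |α - 1| * f₁ / H := by
      rw [hf2e, abs_div, abs_mul, abs_of_pos hf1, abs_of_pos hH]
    have h3 : |f₂| * |k| ≤ |f₂| * (y * XH) := mul_le_mul_of_nonneg_left hk (abs_nonneg _)
    have h4 : |f₂| * (y * XH) = f₁ * y ^ 2 * ((|α - 1| * H / (α ^ 2 * f ^ 2)) * X / y) := by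
      rw [h2, hXHe, hf1e]; field_simp
    have h5 : |α - 1| * H / (α ^ 2 * f ^ 2) ≤ K₁ := by
      rw [hK₁]
      have : 4 * α ^ 2 * c ^ 2 ≤ α ^ 2 * f ^ 2 := by
        have : (2 * c) ^ 2 ≤ f ^ 2 := by gcongr
        linarith only [mul_le_mul_of_nonneg_left this (sq_nonneg α)]
      gcongr
    calc _ ≤ _ := h1
      _ ≤ _ := h3
      _ = _ := h4
      _ ≤ _ := by gcongr
  have eK : |(1 - α) * H / α| ≤ K₂ := by
    rw [abs_div, abs_mul, abs_of_pos hH, abs_of_pos hα, abs_sub_comm, hK₂]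
    gcongr
  have e2 : (f - f₁ * H) * t ≤ f₁ * y ^ 2 * (K₂ * y) := by
    have h1 : (1 - α) * H / α * t ≤ K₂ * y ^ 3 := by
      refine (le_abs_self _).trans ?_
      rw [abs_mul]
      gcongr
    calc (f - f₁ * H) * t = f₁ * ((1 - α) * H / α * t) := by rw [hd]; ring
      _ ≤ f₁ * (K₂ * y ^ 3) := by gcongr
      _ = _ := by ring
  have e3 : -(y ^ 2 * ((f - f₁ * H) * w) / ψ) ≤ f₁ * y ^ 2 * (K₂ / ψ) := by
    have h1 : -((1 - α) * H / α * w) ≤ K₂ := by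
      refine (neg_le_abs _).trans ?_
      rw [abs_mul]
      calc _ ≤ K₂ * 1 := by gcongr
        _ = K₂ := mul_one _
    have h2 : -(y ^ 2 * ((f - f₁ * H) * w) / ψ)
        = f₁ * y ^ 2 * (-((1 - α) * H / α * w) / ψ) := by rw [hd]; ring
    rw [h2]
    gcongr
  have e4 : 2 * χ' * Z / (χ * ψ) ≤ c ^ 4 / 16 * X + 64 / c ^ 6 / ψ ^ 2 := by
    have hq : 0 ≤ χ' / χ ∧ χ' / χ ≤ 2 / c := by
      refine ⟨by positivity, ?_⟩
      rw [div_le_div_iff₀ hχ hc]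
      linarith only [mul_le_mul_of_nonneg_right b5 hc.le, b1]
    set m := χ' / χ
    have h1 : 2 * χ' * Z / (χ * ψ) = 2 * (m * Z) / ψ := by simp only [m]; field_simp
    have h2 : (m * Z) ^ 2 ≤ (2 / c) ^ 2 * X := by
      rw [mul_pow]
      have : Z ^ 2 ≤ X := hZ.trans (mul_le_of_le_one_right hX0 hG)
      have : m ^ 2 ≤ (2 / c) ^ 2 := by exact pow_le_pow_left₀ hq.1 hq.2 2
      calc _ ≤ (2 / c) ^ 2 * Z ^ 2 := by gcongr
        _ ≤ _ := by gcongr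
    -- Young's inequality, weighted so that half of the good term `c ^ 4 / 8 * X` is used
    have h3 : 2 * (m * Z) / ψ ≤ c ^ 6 / 64 * (m * Z) ^ 2 + 64 / c ^ 6 / ψ ^ 2 := by
      have := sq_nonneg (c ^ 3 / 8 * (m * Z) - 8 / c ^ 3 / ψ)
      have e : (c ^ 3 / 8 * (m * Z) - 8 / c ^ 3 / ψ) ^ 2
        = c ^ 6 / 64 * (m * Z) ^ 2 + 64 / c ^ 6 / ψ ^ 2 - 2 * (m * Z) / ψ := by
        field_simp; ring
      linarith
    have h4 : c ^ 6 / 64 * ((2 / c) ^ 2 * X) = c ^ 4 / 16 * X := by field_simp; ring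
    have h5 : c ^ 6 / 64 * (m * Z) ^ 2 ≤ c ^ 6 / 64 * ((2 / c) ^ 2 * X) := by gcongr
    rw [h1]
    linarith
  have e5 : 2 * G / ψ ^ 2 ≤ 2 / ψ ^ 2 := by gcongr; linarith
  -- the good terms, from `f χ' - χ ≥ c / 2` and `χ ≤ 2 / c`
  have e6 : y ^ 2 + c ^ 2 / 4 * y ^ 2 + c ^ 4 / 8 * X
      ≤ (χ' * f * y ^ 2 + 2 * (c ^ 3 / 8) * X) / χ := by
    rw [le_div_iff₀ hχ]
    have h1 : χ * c ≤ 2 := by rwa [le_div_iff₀ hc] at b2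
    have h2 : (1 + c ^ 2 / 4) * χ ≤ χ' * f := by
      linarith [mul_le_mul_of_nonneg_left h1 hc.le]
    have h3 : c ^ 4 / 8 * χ ≤ 2 * (c ^ 3 / 8) := by
      have : 0 ≤ c ^ 3 / 8 := by positivity
      linarith [mul_le_mul_of_nonneg_left h1 this]
    linarith [mul_le_mul_of_nonneg_right h2 (sq_nonneg y), mul_le_mul_of_nonneg_right h3 hX0]
  have hfin : 0 ≤ f₁ * y ^ 2 * (K₁ * X / y + K₂ * y + K₂ / ψ + (c ^ 4 / 16 * X + 64 / c ^ 6 / ψ ^ 2)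
      + 2 / ψ ^ 2 - c ^ 2 / 4 * y ^ 2 - c ^ 4 / 8 * X) := by
    have hp : 0 < f₁ * y ^ 2 := by positivity
    have a1 := mul_le_mul_of_nonneg_left (add_le_add e4 e5) hp.le
    have a2 := mul_le_mul_of_nonneg_left e6 hp.le
    have a3 : f₁ * y ^ 2 * ((χ' * f * y ^ 2 + 2 * (c ^ 3 / 8) * X) / χ)
      = y ^ 2 / χ * f₁ * (χ' * f * y ^ 2 + 2 * (c ^ 3 / 8) * X) := by ring
    rw [a3] at a2
    linarith only [e1, e2, e3, a1, a2, hmain]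
  exact le_threshold_of_nonneg hα hc hy hψ hψa hX0
    (nonneg_of_mul_nonneg_right hfin (by positivity))

namespace FormalFlow
open FormalGraph

variable {ι A : Type*} [Fintype ι] [DecidableEq ι] [CommRing A] [Algebra ℝ A]
  (F : FormalFlow ι A)

/-! ### The test function and its evolution -/

lemma L_algebraMap (s : ℝ) : F.L (algebraMap ℝ A s) = 0 := by
  simp [L]

lemma L_sub (φ χ : A) : F.L (φ - χ) = F.L φ - F.L χ := map_sub F.LHom φ χ

lemma Γ_algebraMap_left (s : ℝ) (φ : A) : F.Γ (algebraMap ℝ A s) φ = 0 := by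
  simp [Γ]

lemma Γ_sub_left (φ φ' χ : A) : F.Γ (φ - φ') χ = F.Γ φ χ - F.Γ φ' χ := by
  simp only [Γ, map_sub, mul_sub, sub_mul, Finset.sum_sub_distrib]

lemma Γ_mul_left (φ φ' χ : A) : F.Γ (φ * φ') χ = φ * F.Γ φ' χ + φ' * F.Γ φ χ := by
  simp only [Γ, Finset.mul_sum, ← Finset.sum_add_distrib]
  refine Finset.sum_congr rfl fun i _ => Finset.sum_congr rfl fun j _ => ?_
  simp only [Derivation.leibniz, smul_eq_mul]; ring

/-- The localization function `a - U`, without the truncation at zero. -/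
noncomputable def ψ (a : ℝ) : A := algebraMap ℝ A a - F.U

/-- The weight `speedWeight c f` as an element of the algebra. -/
noncomputable def χ (c : ℝ) : A := F.f - algebraMap ℝ A c - algebraMap ℝ A (c ^ 3 / 8) * (F.f * F.f)

/-- The function `J = ψ² |A|² - M² χ²`. If `M` is the maximum of `ψ|A|/χ`, then `J ≤ 0`, with equality
where the maximum is attained. -/
noncomputable def J (a c M : ℝ) : A :=
  F.ψ a * F.ψ a * F.q - algebraMap ℝ A (M ^ 2) * (F.χ c * F.χ c)

/-- The derivative of `speedWeight c` at `f`. -/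
noncomputable def χ' (c : ℝ) : A := 1 - 2 * algebraMap ℝ A (c ^ 3 / 8) * F.f

omit [DecidableEq ι] in
lemma δ_ψ (a : ℝ) (i : ι) : F.δ i (F.ψ a) = -F.δ i F.U := by
  simp [ψ]

omit [DecidableEq ι] in
lemma δ_χ (c : ℝ) (i : ι) : F.δ i (F.χ c) = F.χ' c * F.δ i F.f := by
  simp only [χ, χ', map_sub, Derivation.leibniz, smul_eq_mul, Derivation.map_algebraMap]
  ring

lemma Γ_χ (c : ℝ) (φ : A) : F.Γ (F.χ c) φ = F.χ' c * F.Γ F.f φ := by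
  simp only [Γ, δ_χ, Finset.mul_sum]
  exact Finset.sum_congr rfl fun _ _ => Finset.sum_congr rfl fun _ _ => by ring

lemma L_ψ (a : ℝ) : F.L (F.ψ a) = -((F.f - F.f₁ * F.H) * F.w) := by
  rw [ψ, L_sub, L_algebraMap, L_U, zero_sub]

lemma L_χ (c : ℝ) : F.L (F.χ c) = F.f₁ * (F.χ' c * F.f * F.q
    + 2 * algebraMap ℝ A (c ^ 3 / 8) * F.Γ F.f F.f) := by
  simp only [χ, χ', L_sub, L_algebraMap, L_mul, Γ_algebraMap_left, L_f]
  ring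

lemma L_J (a c M : ℝ) : F.L (F.J a c M) =
    F.ψ a * F.ψ a * (2 * (F.f₂ * F.hHH + F.f₁ * F.q ^ 2 + (F.f - F.f₁ * F.H) * F.trS3 - F.f₁ * F.R))
    + F.q * (2 * F.ψ a * -((F.f - F.f₁ * F.H) * F.w) - 2 * F.f₁ * F.Γ F.U F.U)
    + 4 * F.f₁ * F.ψ a * F.Γ F.U F.q
    - algebraMap ℝ A (M ^ 2) * (2 * F.χ c * (F.f₁ * (F.χ' c * F.f * F.q
        + 2 * algebraMap ℝ A (c ^ 3 / 8) * F.Γ F.f F.f)) - 2 * F.f₁ * F.χ' c ^ 2 * F.Γ F.f F.f) := by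
  have h1 (φ : A) : F.Γ (F.ψ a) φ = -F.Γ F.U φ := by
    rw [ψ, Γ_sub_left, Γ_algebraMap_left, zero_sub]
  have h2 : F.Γ F.f (F.χ c) = F.χ' c * F.Γ F.f F.f := by rw [Γ_comm, Γ_χ]
  have h3 : F.Γ F.U (F.ψ a) = -F.Γ F.U F.U := by rw [Γ_comm, h1]
  simp only [J, L_sub, L_mul, L_algebraMap, Γ_algebraMap_left, Γ_χ, h2, L_χ, L_ψ, L_q, Γ_mul_left,
    h1, h3]
  ring

variable (ev : A →ₐ[ℝ] ℝ)

lemma ΓR_comb (s t : ℝ) (a b : ι → ℝ) :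
    F.ΓR ev (fun i => s * a i + t * b i) (fun i => s * a i + t * b i)
      = s ^ 2 * F.ΓR ev a a + 2 * s * t * F.ΓR ev a b + t ^ 2 * F.ΓR ev b b := by
  have hab : F.ΓR ev a b = F.ΓR ev b a := by
    rw [ΓR, ΓR, Finset.sum_comm]
    exact Finset.sum_congr rfl fun i _ => Finset.sum_congr rfl fun j _ => by
      rw [F.P_symm]; ring
  have : 2 * s * t * F.ΓR ev a b = s * t * F.ΓR ev a b + t * s * F.ΓR ev b a := by
    rw [hab]; ring
  rw [this]
  simp only [ΓR, Finset.mul_sum, ← Finset.sum_add_distrib]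
  exact Finset.sum_congr rfl fun i _ => Finset.sum_congr rfl fun j _ => by ring

lemma ev_Γ_sq_le (φ χ : A) :
    ev (F.Γ φ χ) ^ 2 ≤ ev (F.Γ φ φ) * ev (F.Γ χ χ) := by
  simp only [ev_Γ]
  set a := fun i => ev (F.δ i φ)
  set b := fun i => ev (F.δ i χ)
  have h (s : ℝ) : 0 ≤ F.ΓR ev a a * (s * s) + 2 * F.ΓR ev a b * s + F.ΓR ev b b := by
    have := F.ΓR_self_nonneg ev (fun i => s * a i + 1 * b i)
    rw [ΓR_comb] at this
    linarith
  have := discrim_le_zero h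
  rw [discrim] at this
  linarith

/-- The estimate at a point where `J` vanishes together with its gradient and `𝓛 J ≥ 0`. The gradient
condition says `∇ log |A| = ∇ log χ - ∇ log ψ`, which is inserted into Kato's inequality. -/
theorem ev_curvature_le {α c a M : ℝ} (hα : 0 < α) (hc : 0 < c)
    (hf₁ : 2 * c ≤ ev F.f) (hf₂ : ev F.f ≤ 2 / c) (hH : 0 < ev F.H)
    (hHf : ev F.f = ev F.H ^ α)
    (hf₁H : ev F.f₁ * ev F.H = α * ev F.f) (hf₂H : ev F.f₂ * ev F.H = (α - 1) * ev F.f₁)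
    (hq : 0 < ev F.q) (hψ : 0 < ev (F.ψ a)) (hψa : ev (F.ψ a) ≤ a)
    (hJ : ev (F.J a c M) = 0) (hδJ : ∀ i, ev (F.δ i (F.J a c M)) = 0)
    (hLJ : 0 ≤ ev (F.L (F.J a c M))) :
    ev (F.ψ a) * √(ev F.q) ≤ threshold α c a := by
  have hf0 : 0 < ev F.f := by linarith
  have hχe : ev (F.χ c) = speedWeight c (ev F.f) := by
    simp only [χ, speedWeight, map_sub, map_mul, AlgHom.commutes, Algebra.algebraMap_self,
      RingHom.id_apply]
    ring
  have hχ'e : ev (F.χ' c) = 1 - 2 * (c ^ 3 / 8) * ev F.f := by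
    simp only [χ', map_sub, map_mul, AlgHom.commutes, Algebra.algebraMap_self,
      RingHom.id_apply, map_one, map_ofNat]
  have hχ0 : 0 < ev (F.χ c) := by
    rw [hχe]; linarith [(speedWeight_bounds hc hf₁ hf₂).1]
  have hJ' : ev (F.ψ a) * ev (F.ψ a) * ev F.q = M ^ 2 * (ev (F.χ c) * ev (F.χ c)) := by
    simp only [J, map_sub, map_mul, AlgHom.commutes, Algebra.algebraMap_self,
      RingHom.id_apply] at hJ
    linarith
  set ψ0 := ev (F.ψ a) with hψ0
  set χ0 := ev (F.χ c) with hχ0'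
  set m := ev (F.χ' c) with hm
  -- `J = 0` determines `M`
  have hM : M ^ 2 = ψ0 ^ 2 * ev F.q / χ0 ^ 2 := by
    rw [eq_div_iff (by positivity)]; linarith
  set lam : ι → ℝ := fun i => (m / χ0) * ev (F.δ i F.f) + (1 / ψ0) * ev (F.δ i F.U) with hlam
  have hqi (i : ι) : ev (F.δ i F.q) = 2 * (ev F.q * lam i) := by
    have h1 := hδJ i
    simp only [J, map_sub, map_mul, map_add, map_neg, Derivation.leibniz, smul_eq_mul, δ_ψ, δ_χ,
      AlgHom.commutes, Algebra.algebraMap_self, RingHom.id_apply, Derivation.map_algebraMap,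
      map_zero, mul_zero, ← hψ0, ← hχ0', ← hm, hM] at h1
    have h2 : ψ0 ^ 2 * (ev (F.δ i F.q) - 2 * (ev F.q * lam i)) = 0 := by
      rw [← h1, hlam]
      field_simp
      ring
    have h3 := (mul_eq_zero.mp h2).resolve_left (by positivity)
    linarith
  have hkato := F.kato ev lam hqi
  rw [hlam, ΓR_comb] at hkato
  have hΓUq : ev (F.Γ F.U F.q) = 2 * ev F.q * (m / χ0 * ev (F.Γ F.f F.U)
      + 1 / ψ0 * ev (F.Γ F.U F.U)) := by
    rw [Γ_comm F F.f F.U]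
    simp only [ev_Γ, hqi, ΓR, Finset.mul_sum, ← Finset.sum_add_distrib, hlam]
    exact Finset.sum_congr rfl fun i _ => Finset.sum_congr rfl fun j _ => by ring
  simp only [← ev_Γ] at hkato
  have hf1 : 0 < ev F.f₁ := by
    have : 0 < ev F.f₁ * ev F.H := by rw [hf₁H]; positivity
    exact (pos_iff_pos_of_mul_pos this).mpr hH
  have hy : 0 < √(ev F.q) := Real.sqrt_pos.mpr hq
  have hy2 : √(ev F.q) ^ 2 = ev F.q := Real.sq_sqrt hq.le
  have hw : ev (F.Γ F.U F.U) = 1 - ev F.w * ev F.w := by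
    rw [Γ_U_U]; simp
  have hΓ0 (φ : A) : 0 ≤ ev (F.Γ φ φ) := by rw [ev_Γ]; exact F.ΓR_self_nonneg ev _
  have hΓff : F.Γ F.f F.f = F.f₁ * F.f₁ * F.Γ F.H F.H := by
    simp only [Γ, F.δ_f, Finset.mul_sum]
    exact Finset.sum_congr rfl fun _ _ => Finset.sum_congr rfl fun _ _ => by ring
  refine curvature_le_threshold (f := ev F.f) (H := ev F.H) (f₁ := ev F.f₁) (f₂ := ev F.f₂)
    (t := ev F.trS3) (k := ev F.hHH) (w := ev F.w) (X := ev (F.Γ F.f F.f)) (Z := ev (F.Γ F.f F.U))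
    (G := ev (F.Γ F.U F.U)) (XH := ev (F.Γ F.H F.H)) hα hc hf₁ hf₂ hH ?_ hf₁H hf₂H hy ?_ ?_ ?_
    (hΓ0 _) ?_ hψ hψa ?_ (F.ev_Γ_sq_le ev _ _) ?_
  · have : ev F.H = (ev F.f) ^ (1 / α) := by
      rw [hHf, ← Real.rpow_mul hH.le, mul_one_div_cancel hα.ne', Real.rpow_one]
    rw [this]
    gcongr
  · apply abs_le_of_sq_le_sq _ (by positivity)
    calc ev F.trS3 ^ 2 ≤ ev F.q ^ 3 := F.ev_trS3_sq_le ev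
      _ = _ := by rw [← pow_mul, pow_mul' _ 3 2, hy2]
  · apply abs_le_of_sq_le_sq _ (mul_nonneg hy.le (hΓ0 _))
    calc ev F.hHH ^ 2 ≤ ev F.q * ev (F.Γ F.H F.H) ^ 2 := F.ev_hHH_sq_le ev
      _ = _ := by rw [mul_pow, hy2]
  · rw [hΓff]; simp only [map_mul]; ring
  · have := hΓ0 F.U
    rw [hw] at this
    rw [abs_le_one_iff_mul_self_le_one]
    linarith
  · rw [hw]; linarith [mul_self_nonneg (ev F.w)]
  · rw [L_J] at hLJ
    simp only [map_sub, map_mul, map_add, map_neg, AlgHom.commutes, Algebra.algebraMap_self,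
      RingHom.id_apply, map_ofNat, map_pow, ← hψ0, ← hχ0', ← hm, hM, hΓUq] at hLJ
    have h1 := mul_nonneg hf1.le (sub_nonneg.mpr hkato)
    have h2 := add_nonneg (div_nonneg hLJ (by positivity : 0 ≤ 2 * ψ0 ^ 2)) h1
    rw [← hχe, ← hχ'e, show √(ev F.q) ^ 4 = (√(ev F.q) ^ 2) ^ 2 by ring, hy2]
    refine h2.trans_eq ?_
    field_simp
    ring

end FormalFlow

/-! ### The algebra of smooth functions on an open set -/

section SmoothFunctions

variable {E : Type*} [NormedAddCommGroup E] [NormedSpace ℝ E]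

/-- The algebra of functions that are smooth on `Ω`. The values outside of `Ω` are arbitrary, so two
elements that agree on `Ω` need not be equal. -/
def smoothOn (Ω : Set E) : Subalgebra ℝ (E → ℝ) where
  carrier := {φ | ContDiffOn ℝ ∞ φ Ω}
  mul_mem' h₁ h₂ := ContDiffOn.mul h₁ h₂
  add_mem' h₁ h₂ := ContDiffOn.add h₁ h₂
  algebraMap_mem' r := contDiffOn_const (c := r)

variable {Ω : Set E}

lemma smoothOn.contDiffAt (hΩ : IsOpen Ω) (φ : smoothOn Ω) {z : E} (hz : z ∈ Ω) :
    ContDiffAt ℝ ∞ (φ : E → ℝ) z :=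
  ContDiffOn.contDiffAt φ.2 (hΩ.mem_nhds hz)

lemma smoothOn.differentiableAt (hΩ : IsOpen Ω) (φ : smoothOn Ω) {z : E} (hz : z ∈ Ω) :
    DifferentiableAt ℝ (φ : E → ℝ) z :=
  (smoothOn.contDiffAt hΩ φ hz).differentiableAt (by simp)

lemma contDiffOn_indicator_fderiv (hΩ : IsOpen Ω) {φ : E → ℝ} (hφ : ContDiffOn ℝ ∞ φ Ω) (v : E) :
    ContDiffOn ℝ ∞ (Ω.indicator fun z => fderiv ℝ φ z v) Ω :=
  ((hφ.fderiv_of_isOpen hΩ (m := ∞) (by simp)).clm_apply contDiffOn_const).congr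
    fun _ hz => Set.indicator_of_mem hz _

/-- The derivative in the direction `v` as a derivation of `smoothOn Ω`. It is extended by zero
outside of `Ω`, which makes the Leibniz rule hold everywhere. -/
noncomputable def dirDeriv (hΩ : IsOpen Ω) (v : E) : Derivation ℝ (smoothOn Ω) (smoothOn Ω) :=
  Derivation.mk'
    { toFun := fun φ => ⟨Ω.indicator fun z => fderiv ℝ (φ : E → ℝ) z v,
        show ContDiffOn ℝ ∞ _ Ω from contDiffOn_indicator_fderiv hΩ φ.2 v⟩
      map_add' := fun φ χ => by
        ext z
        by_cases hz : z ∈ Ω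
        · simp [hz, fderiv_add (smoothOn.differentiableAt hΩ φ hz)
            (smoothOn.differentiableAt hΩ χ hz)]
        · simp [hz]
      map_smul' := fun r φ => by
        ext z
        by_cases hz : z ∈ Ω
        · simp [hz, fderiv_const_smul (smoothOn.differentiableAt hΩ φ hz)]
        · simp [hz] }
    fun φ χ => by
      ext z
      by_cases hz : z ∈ Ω
      · simp [hz, fderiv_mul (smoothOn.differentiableAt hΩ φ hz)
          (smoothOn.differentiableAt hΩ χ hz)]
      · simp [hz]

lemma coe_dirDeriv (hΩ : IsOpen Ω) (v : E) (φ : smoothOn Ω) :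
    (dirDeriv hΩ v φ : E → ℝ) = Ω.indicator fun z => fderiv ℝ (φ : E → ℝ) z v := rfl

lemma dirDeriv_apply (hΩ : IsOpen Ω) (v : E) (φ : smoothOn Ω) {z : E} (hz : z ∈ Ω) :
    (dirDeriv hΩ v φ : E → ℝ) z = fderiv ℝ φ z v := by
  rw [coe_dirDeriv, Set.indicator_of_mem hz]

lemma dirDeriv_apply_of_notMem (hΩ : IsOpen Ω) (v : E) (φ : smoothOn Ω) {z : E} (hz : z ∉ Ω) :
    (dirDeriv hΩ v φ : E → ℝ) z = 0 := by
  rw [coe_dirDeriv, Set.indicator_of_notMem hz]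

lemma dirDeriv_dirDeriv_apply (hΩ : IsOpen Ω) (v v' : E) (φ : smoothOn Ω) {z : E} (hz : z ∈ Ω) :
    (dirDeriv hΩ v (dirDeriv hΩ v' φ) : E → ℝ) z = fderiv ℝ (fderiv ℝ (φ : E → ℝ)) z v v' := by
  rw [dirDeriv_apply hΩ v _ hz]
  have h1 : (dirDeriv hΩ v' φ : E → ℝ) =ᶠ[𝓝 z] fun y => fderiv ℝ (φ : E → ℝ) y v' :=
    Filter.eventually_of_mem (hΩ.mem_nhds hz) fun y hy => dirDeriv_apply hΩ v' φ hy
  have h2 : DifferentiableAt ℝ (fderiv ℝ (φ : E → ℝ)) z :=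
    ((smoothOn.contDiffAt hΩ φ hz).fderiv_right (m := 1)
    (by rw [one_add_one_eq_two]; exact ENat.LEInfty.out)).differentiableAt (by simp)
  rw [h1.fderiv_eq, fderiv_clm_apply h2 (differentiableAt_const v')]
  simp

lemma dirDeriv_comm (hΩ : IsOpen Ω) (v v' : E) (φ : smoothOn Ω) :
    dirDeriv hΩ v (dirDeriv hΩ v' φ) = dirDeriv hΩ v' (dirDeriv hΩ v φ) := by
  ext z
  by_cases hz : z ∈ Ω
  · rw [dirDeriv_dirDeriv_apply hΩ v v' φ hz, dirDeriv_dirDeriv_apply hΩ v' v φ hz]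
    exact ((smoothOn.contDiffAt hΩ φ hz).isSymmSndFDerivAt (by simpa using ENat.LEInfty.out)).eq v v'
  · rw [dirDeriv_apply_of_notMem hΩ _ _ hz, dirDeriv_apply_of_notMem hΩ _ _ hz]

/-- Evaluation at a point. -/
def evalAt (Ω : Set E) (z : E) : smoothOn Ω →ₐ[ℝ] ℝ :=
  (Pi.evalAlgHom ℝ (fun _ : E => ℝ) z).comp (smoothOn Ω).val

lemma evalAt_apply (z : E) (φ : smoothOn Ω) : evalAt Ω z φ = (φ : E → ℝ) z := rfl

end SmoothFunctions

/-! ### Derivative tests at a maximum -/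

section DerivativeTests

/-- If the second derivative were positive, the point would also be a local minimum, and the function
would be locally constant. -/
lemma deriv_deriv_nonpos_of_isLocalMax {g : ℝ → ℝ} {s : ℝ} (h : IsLocalMax g s)
    (hc : ContinuousAt g s) : deriv (deriv g) s ≤ 0 := by
  by_contra! hpos
  have h1 : IsLocalMin g s := isLocalMin_of_deriv_deriv_pos hpos h.deriv_eq_zero hc
  have h2 : g =ᶠ[𝓝 s] fun _ => g s := by
    filter_upwards [h, h1] with x hx hx'
    exact le_antisymm hx hx'
  have h3 : deriv g =ᶠ[𝓝 s] fun _ => 0 := by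
    refine h2.deriv.trans (Filter.Eventually.of_forall fun x => ?_)
    simp
  rw [h3.deriv_eq] at hpos
  simp at hpos

variable {E : Type*} [NormedAddCommGroup E] [NormedSpace ℝ E]

lemma fderiv_eq_zero_of_isLocalMax_line {φ : E → ℝ} {z v : E} (hφ : DifferentiableAt ℝ φ z)
    (hmax : IsLocalMax (fun s : ℝ => φ (z + s • v)) 0) : fderiv ℝ φ z v = 0 := by
  have := hmax.deriv_eq_zero
  rwa [show deriv (fun s : ℝ => φ (z + s • v)) 0 = lineDeriv ℝ φ z v from rfl,
    hφ.lineDeriv_eq_fderiv] at this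

lemma fderiv_fderiv_nonpos_of_isLocalMax_line {φ : E → ℝ} {z v : E} (hφ : ContDiffAt ℝ ∞ φ z)
    (hmax : IsLocalMax (fun s : ℝ => φ (z + s • v)) 0) :
    fderiv ℝ (fderiv ℝ φ) z v v ≤ 0 := by
  have hline (s : ℝ) : HasDerivAt (fun s : ℝ => z + s • v) v s := by
    simpa using ((hasDerivAt_id s).smul_const v).const_add z
  have hz : z + (0 : ℝ) • v = z := by simp
  have hc : ContinuousAt (fun s : ℝ => z + s • v) 0 := (hline 0).continuousAt
  have hd : ∀ᶠ y in 𝓝 z, DifferentiableAt ℝ φ y := by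
    filter_upwards [(hφ.of_le (m := 1) (mod_cast le_top)).eventually (by simp)] with y hy
    exact hy.differentiableAt (by simp)
  have h1 : deriv (fun s : ℝ => φ (z + s • v)) =ᶠ[𝓝 0] fun s => fderiv ℝ φ (z + s • v) v := by
    have := hc.eventually (p := fun y => DifferentiableAt ℝ φ y) (by simpa using hd)
    filter_upwards [this] with s hs
    exact (hs.hasFDerivAt.comp_hasDerivAt s (hline s)).deriv
  have h2 : DifferentiableAt ℝ (fderiv ℝ φ) z :=
    (hφ.fderiv_right (m := 1)
    (by rw [one_add_one_eq_two]; exact ENat.LEInfty.out)).differentiableAt (by simp)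
  have h3 : HasDerivAt (fun s : ℝ => fderiv ℝ φ (z + s • v)) (fderiv ℝ (fderiv ℝ φ) z v) 0 := by
    have h2' : HasFDerivAt (fderiv ℝ φ) (fderiv ℝ (fderiv ℝ φ) z) (z + (0 : ℝ) • v) := by
      rw [hz]; exact h2.hasFDerivAt
    exact h2'.comp_hasDerivAt 0 (hline 0)
  have h4 : deriv (fun s : ℝ => fderiv ℝ φ (z + s • v) v) 0 = fderiv ℝ (fderiv ℝ φ) z v v := by
    simpa using (h3.clm_apply (hasDerivAt_const 0 v)).deriv
  rw [← h4, ← h1.deriv_eq]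
  refine deriv_deriv_nonpos_of_isLocalMax hmax ?_
  have : ContinuousAt φ (z + (0 : ℝ) • v) := by rw [hz]; exact hφ.continuousAt
  exact ContinuousAt.comp (f := fun s : ℝ => z + s • v) this hc

lemma fderiv_nonneg_of_le_before {φ : E → ℝ} {z v : E} (hφ : DifferentiableAt ℝ φ z)
    (hmax : ∀ᶠ s : ℝ in 𝓝[<] 0, φ (z + s • v) ≤ φ z) : 0 ≤ fderiv ℝ φ z v := by
  rw [← hφ.lineDeriv_eq_fderiv]
  have h1 : HasDerivAt (fun s : ℝ => φ (z + s • v)) (lineDeriv ℝ φ z v) 0 :=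
    hφ.lineDifferentiableAt.hasDerivAt
  have h2 := (hasDerivAt_iff_tendsto_slope.mp h1).mono_left
    (nhdsWithin_mono 0 (fun x hx => (ne_of_lt hx : x ≠ 0)) : 𝓝[<] (0 : ℝ) ≤ _)
  refine ge_of_tendsto h2 ?_
  filter_upwards [hmax, self_mem_nhdsWithin] with s hs hs0
  simp only [slope, vsub_eq_sub, sub_zero, zero_smul, add_zero, smul_eq_mul]
  exact mul_nonneg_of_nonpos_of_nonpos (inv_nonpos.mpr (le_of_lt hs0)) (by linarith)

end DerivativeTests

/-! ### The geometry of a graph in terms of its gradient and Hessian -/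

section GraphGeometry

variable {n : ℕ}

/-- The map `point` as a continuous linear map. -/
noncomputable def pointL (n : ℕ) : Base n × ℝ →L[ℝ] Amb n :=
  LinearMap.toContinuousLinearMap
    { toFun := fun y => point y.1 y.2
      map_add' := fun y z => by
        ext i
        refine Fin.lastCases ?_ (fun i => ?_) i <;> simp [point]
      map_smul' := fun c y => by
        ext i
        refine Fin.lastCases ?_ (fun i => ?_) i <;> simp [point] }

lemma pointL_apply (y : Base n × ℝ) : pointL n y = point y.1 y.2 := rfl

lemma inner_point (x y : Base n) (r s : ℝ) : ⟪point x r, point y s⟫ = ⟪x, y⟫ + r * s := by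
  simp [point, PiLp.inner_apply, Fin.sum_univ_castSucc, mul_comm]

/-- `1/√(1 + |d|²)` for a gradient `d`. -/
noncomputable def slopeW (d : Fin n → ℝ) : ℝ := (√(1 + ∑ i, d i ^ 2))⁻¹

/-- The inverse metric of a graph with gradient `d`. -/
noncomputable def invMetric (d : Fin n → ℝ) (i j : Fin n) : ℝ :=
  (if i = j then 1 else 0) - slopeW d * d i * (slopeW d * d j)

/-- The shape operator of a graph with gradient `d` and Hessian `m`. -/
noncomputable def shape (d : Fin n → ℝ) (m : Fin n → Fin n → ℝ) (i j : Fin n) : ℝ :=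
  ∑ k, invMetric d i k * (slopeW d * m k j)

/-- The partial derivatives of `g`. -/
noncomputable def grad (g : Base n → ℝ) (x : Base n) (i : Fin n) : ℝ :=
  fderiv ℝ g x (EuclideanSpace.single i 1)

/-- The second partial derivatives of `g`. -/
noncomputable def hess (g : Base n → ℝ) (x : Base n) (i j : Fin n) : ℝ :=
  fderiv ℝ (fderiv ℝ g) x (EuclideanSpace.single j 1) (EuclideanSpace.single i 1)

lemma invMetric_symm (d : Fin n → ℝ) (i j : Fin n) : invMetric d i j = invMetric d j i := by
  simp only [invMetric, eq_comm (a := i), mul_comm (slopeW d * d i)]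

lemma slopeW_sq (d : Fin n → ℝ) : slopeW d * slopeW d * (1 + ∑ i, d i * d i) = 1 := by
  have h : 0 < 1 + ∑ i, d i ^ 2 := by
    have : 0 ≤ ∑ i, d i ^ 2 := Finset.sum_nonneg fun _ _ => sq_nonneg _
    linarith
  simp only [slopeW, ← sq]
  rw [inv_pow, Real.sq_sqrt h.le, inv_mul_cancel₀ h.ne']

lemma pderiv_graphMap {g : Base n → ℝ} {x : Base n} (hg : DifferentiableAt ℝ g x) (i : Fin n) :
    pderiv i (graphMap g) x = point (EuclideanSpace.single i 1) (grad g x i) := by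
  have h : HasFDerivAt (graphMap g)
      ((pointL n).comp ((ContinuousLinearMap.id ℝ _).prod (fderiv ℝ g x))) x :=
    (pointL n).hasFDerivAt.comp x ((hasFDerivAt_id x).prodMk hg.hasFDerivAt)
  rw [pderiv, h.fderiv]
  rfl

lemma pderiv_pderiv_graphMap {g : Base n → ℝ} {x : Base n} (hg : ContDiffAt ℝ 2 g x)
    (i j : Fin n) : pderiv j (pderiv i (graphMap g)) x = point 0 (hess g x i j) := by
  have h1 : pderiv i (graphMap g) =ᶠ[𝓝 x] fun y => pointL n (EuclideanSpace.single i 1,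
      fderiv ℝ g y (EuclideanSpace.single i 1)) := by
    filter_upwards [hg.eventually (by simp)] with y hy
    exact pderiv_graphMap (hy.differentiableAt (by simp)) i
  have h2 : DifferentiableAt ℝ (fderiv ℝ g) x :=
    (hg.fderiv_right (m := 1) (by rw [one_add_one_eq_two])).differentiableAt (by simp)
  have h3 := (pointL n).hasFDerivAt.comp x ((hasFDerivAt_const (EuclideanSpace.single i (1 : ℝ)) x).prodMk
    (h2.hasFDerivAt.clm_apply (hasFDerivAt_const (EuclideanSpace.single i (1 : ℝ)) x)))
  have h4 : HasFDerivAt (fun y => pointL n (EuclideanSpace.single i 1,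
      fderiv ℝ g y (EuclideanSpace.single i 1))) _ x := h3
  rw [pderiv, h1.fderiv_eq, h4.fderiv]
  simp [pointL_apply, hess]

lemma gradient_apply (g : Base n → ℝ) (x : Base n) (i : Fin n) :
    gradient g x i = grad g x i := by
  have : ⟪gradient g x, EuclideanSpace.single i 1⟫ = grad g x i := by
    rw [gradient, InnerProductSpace.toDual_symm_apply, grad]
  rw [← this, EuclideanSpace.inner_single_right]
  simp

lemma norm_gradient_sq (g : Base n → ℝ) (x : Base n) :
    ‖gradient g x‖ ^ 2 = ∑ i, grad g x i ^ 2 := by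
  simp [EuclideanSpace.real_norm_sq_eq, gradient_apply]

lemma graphNormal_eq (g : Base n → ℝ) (x : Base n) :
    graphNormal g x = slopeW (grad g x) • point (-gradient g x) 1 := by
  rw [graphNormal, norm_gradient_sq, slopeW]

lemma inner_point_zero_graphNormal (g : Base n → ℝ) (x : Base n) (r : ℝ) :
    ⟪point 0 r, graphNormal g x⟫ = slopeW (grad g x) * r := by
  rw [graphNormal_eq, inner_smul_right, inner_point]
  simp

lemma metric_graphMap {g : Base n → ℝ} {x : Base n} (hg : DifferentiableAt ℝ g x) (i j : Fin n) :
    metric (graphMap g) x i j = (if i = j then 1 else 0) + grad g x i * grad g x j := by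
  simp only [metric, Matrix.of_apply, pderiv_graphMap hg, inner_point,
    EuclideanSpace.inner_single_left]
  simp

lemma metric_inv_graphMap {g : Base n → ℝ} {x : Base n} (hg : DifferentiableAt ℝ g x)
    (i j : Fin n) : (metric (graphMap g) x)⁻¹ i j = invMetric (grad g x) i j := by
  have : (metric (graphMap g) x)⁻¹ = Matrix.of (invMetric (grad g x)) := by
    refine Matrix.inv_eq_left_inv ?_
    ext i j
    simp only [Matrix.mul_apply, Matrix.of_apply, metric_graphMap hg, invMetric, sub_mul, mul_add,
      ite_mul, mul_ite, one_mul, zero_mul, mul_one, mul_zero, Finset.sum_sub_distrib,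
      Finset.sum_add_distrib, Finset.sum_ite_eq, Finset.sum_ite_eq', Finset.mem_univ, if_true,
      Matrix.one_apply]
    set d := grad g x
    have h1 : ∑ k, slopeW d * d i * (slopeW d * d k) * (d k * d j)
        = slopeW d * slopeW d * (∑ k, d k * d k) * (d i * d j) := by
      rw [Finset.mul_sum, Finset.sum_mul]
      exact Finset.sum_congr rfl fun k _ => by ring
    rw [h1]
    linear_combination -(d i * d j) * slopeW_sq d
  rw [this, Matrix.of_apply]

lemma secondForm_graphMap {g : Base n → ℝ} {x : Base n} (hg : ContDiffAt ℝ 2 g x) (i j : Fin n) :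
    secondForm (graphMap g) (graphNormal g) x i j = slopeW (grad g x) * hess g x i j := by
  rw [secondForm, Matrix.of_apply, pderiv_pderiv_graphMap hg, inner_point_zero_graphNormal]

lemma hess_symm {g : Base n → ℝ} {x : Base n} (hg : ContDiffAt ℝ 2 g x) (i j : Fin n) :
    hess g x i j = hess g x j i :=
  (hg.isSymmSndFDerivAt (by simp)).eq _ _

lemma graphH_eq {g : Base n → ℝ} {x : Base n} (hg : ContDiffAt ℝ 2 g x) :
    graphH g x = ∑ i, shape (grad g x) (hess g x) i i := by
  simp only [graphH, meanCurvature, shape, metric_inv_graphMap (hg.differentiableAt (by simp)),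
    secondForm_graphMap hg, hess_symm hg]

lemma graphA_eq {g : Base n → ℝ} {x : Base n} (hg : ContDiffAt ℝ 2 g x) :
    graphA g x = √(∑ i, ∑ j, shape (grad g x) (hess g x) i j * shape (grad g x) (hess g x) j i) := by
  simp only [graphA, normA, shape, metric_inv_graphMap (hg.differentiableAt (by simp)),
    secondForm_graphMap hg, Finset.sum_mul_sum]
  congr 1
  rw [Finset.sum_comm]
  conv_rhs => rw [Finset.sum_comm]
  refine Finset.sum_congr rfl fun j _ => ?_
  rw [Finset.sum_comm]
  refine Finset.sum_congr rfl fun i _ => Finset.sum_congr rfl fun k _ =>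
    Finset.sum_congr rfl fun l _ => ?_
  rw [invMetric_symm _ k i, hess_symm hg i l]
  ring

lemma continuous_slopeW : Continuous (slopeW (n := n)) := by
  unfold slopeW
  refine Continuous.inv₀ (by fun_prop) fun d => ?_
  have : 0 ≤ ∑ i, d i ^ 2 := Finset.sum_nonneg fun _ _ => sq_nonneg _
  positivity

lemma continuous_shape (i j : Fin n) :
    Continuous fun y : (Fin n → ℝ) × (Fin n → Fin n → ℝ) => shape y.1 y.2 i j := by
  have := continuous_slopeW (n := n)
  unfold shape invMetric
  fun_prop

end GraphGeometry

/-! ### Smooth solutions of the flow equation -/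

section SmoothFlow

variable {n : ℕ} {Ω : Set (Base n × ℝ)}

/-- The `i`-th space direction in space-time. -/
noncomputable def spaceDir (i : Fin n) : Base n × ℝ := (EuclideanSpace.single i 1, 0)

/-- The time direction in space-time. -/
noncomputable def timeDir (n : ℕ) : Base n × ℝ := (0, 1)

/-- The space gradient of a function on space-time. -/
noncomputable def spaceGrad (V : Base n × ℝ → ℝ) (z : Base n × ℝ) (i : Fin n) : ℝ :=
  fderiv ℝ V z (spaceDir i)

/-- The space Hessian of a function on space-time. -/
noncomputable def spaceHess (V : Base n × ℝ → ℝ) (z : Base n × ℝ) (i j : Fin n) : ℝ :=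
  fderiv ℝ (fderiv ℝ V) z (spaceDir j) (spaceDir i)

/-- The mean curvature of the graphs of the time slices of `V`. -/
noncomputable def meanCurv (V : Base n × ℝ → ℝ) (z : Base n × ℝ) : ℝ :=
  ∑ i, shape (spaceGrad V z) (spaceHess V z) i i

/-- The squared norm `|A|²` for the graphs of the time slices of `V`. -/
noncomputable def sqNormA (V : Base n × ℝ → ℝ) (z : Base n × ℝ) : ℝ :=
  ∑ i, ∑ j, shape (spaceGrad V z) (spaceHess V z) i j * shape (spaceGrad V z) (spaceHess V z) j i

/-- The function `w` as an element of `smoothOn Ω`. -/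
noncomputable def smoothW (hΩ : IsOpen Ω) (U : smoothOn Ω) : smoothOn Ω :=
  ⟨fun z => slopeW fun i => (dirDeriv hΩ (spaceDir i) U : Base n × ℝ → ℝ) z, by
    have h (d : Fin n → ℝ) : 0 < 1 + ∑ i, d i ^ 2 := by
      have : 0 ≤ ∑ i, d i ^ 2 := Finset.sum_nonneg fun _ _ => sq_nonneg _
      linarith
    refine ContDiffOn.inv (ContDiffOn.sqrt (contDiffOn_const.add (ContDiffOn.sum fun i _ =>
      ContDiffOn.pow (dirDeriv hΩ (spaceDir i) U).2 2)) fun z _ => (h _).ne') fun z _ => ?_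
    exact (Real.sqrt_pos.mpr (h _)).ne'⟩

/-- The differential algebra of the graphs of a smooth function on an open subset of space-time. -/
noncomputable def smoothGraph (hΩ : IsOpen Ω) (U : smoothOn Ω) :
    FormalGraph (Fin n) (smoothOn Ω) where
  δ i := dirDeriv hΩ (spaceDir i)
  τ := dirDeriv hΩ (timeDir n)
  U := U
  w := smoothW hΩ U
  δ_comm _ _ _ := dirDeriv_comm hΩ _ _ _
  τ_comm _ _ := dirDeriv_comm hΩ _ _ _
  w_sq := by
    ext z
    simpa [smoothW] using slopeW_sq fun i => (dirDeriv hΩ (spaceDir i) U : Base n × ℝ → ℝ) z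

lemma smoothGraph_S_apply (hΩ : IsOpen Ω) (U : smoothOn Ω) {z : Base n × ℝ} (hz : z ∈ Ω)
    (i j : Fin n) :
    ((smoothGraph hΩ U).S i j : Base n × ℝ → ℝ) z
      = shape (spaceGrad U z) (spaceHess U z) i j := by
  have hd : (fun i => (dirDeriv hΩ (spaceDir i) U : Base n × ℝ → ℝ) z) = spaceGrad U z := by
    funext i; exact dirDeriv_apply hΩ _ U hz
  have hw : (smoothW hΩ U : Base n × ℝ → ℝ) z = slopeW (spaceGrad U z) := by rw [← hd]; rfl
  have hp (i : Fin n) : ((smoothGraph hΩ U).p i : Base n × ℝ → ℝ) z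
      = slopeW (spaceGrad U z) * spaceGrad U z i := by
    rw [← hw, ← hd]; rfl
  have hh (i j : Fin n) : ((smoothGraph hΩ U).h i j : Base n × ℝ → ℝ) z
      = slopeW (spaceGrad U z) * spaceHess U z i j := by
    rw [← hw, spaceHess, ← dirDeriv_dirDeriv_apply hΩ _ _ U hz]; rfl
  have hP (i j : Fin n) : ((smoothGraph hΩ U).P i j : Base n × ℝ → ℝ) z
      = invMetric (spaceGrad U z) i j := by
    have : ((smoothGraph hΩ U).P i j : Base n × ℝ → ℝ) z = (if i = j then 1 else 0)
      - ((smoothGraph hΩ U).p i : Base n × ℝ → ℝ) z * ((smoothGraph hΩ U).p j : Base n × ℝ → ℝ) z := by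
      rw [FormalGraph.P]
      split_ifs <;> rfl
    rw [this, hp, hp]; rfl
  rw [(smoothGraph hΩ U).S_eq, ← evalAt_apply, map_sum, shape]
  refine Finset.sum_congr rfl fun k _ => ?_
  rw [map_mul, evalAt_apply, evalAt_apply, hP, hh]

lemma smoothGraph_H_apply (hΩ : IsOpen Ω) (U : smoothOn Ω) {z : Base n × ℝ} (hz : z ∈ Ω) :
    ((smoothGraph hΩ U).H : Base n × ℝ → ℝ) z = meanCurv U z := by
  rw [FormalGraph.H, ← evalAt_apply, map_sum, meanCurv]
  exact Finset.sum_congr rfl fun i _ => smoothGraph_S_apply hΩ U hz i i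

lemma smoothGraph_q_apply (hΩ : IsOpen Ω) (U : smoothOn Ω) {z : Base n × ℝ} (hz : z ∈ Ω) :
    ((smoothGraph hΩ U).q : Base n × ℝ → ℝ) z = sqNormA U z := by
  rw [FormalGraph.q, ← evalAt_apply, map_sum, sqNormA]
  refine Finset.sum_congr rfl fun i _ => ?_
  rw [map_sum]
  refine Finset.sum_congr rfl fun j _ => ?_
  rw [map_mul, evalAt_apply, evalAt_apply, smoothGraph_S_apply hΩ U hz, smoothGraph_S_apply hΩ U hz]

/-- A real power of a function that is positive on `Ω`. -/
noncomputable def smoothRpow (φ : smoothOn Ω) (hφ : ∀ z ∈ Ω, 0 < (φ : Base n × ℝ → ℝ) z) (s : ℝ) :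
    smoothOn Ω :=
  ⟨fun z => (φ : Base n × ℝ → ℝ) z ^ s,
    show ContDiffOn ℝ ∞ _ Ω from ContDiffOn.rpow_const_of_ne φ.2 fun z hz => (hφ z hz).ne'⟩

lemma dirDeriv_smoothRpow (hΩ : IsOpen Ω) (v : Base n × ℝ) (φ : smoothOn Ω)
    (hφ : ∀ z ∈ Ω, 0 < (φ : Base n × ℝ → ℝ) z) (s : ℝ) :
    dirDeriv hΩ v (smoothRpow φ hφ s)
      = (s • smoothRpow φ hφ (s - 1)) * dirDeriv hΩ v φ := by
  ext z
  by_cases hz : z ∈ Ω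
  · have h1 := (smoothOn.differentiableAt hΩ φ hz).hasFDerivAt.rpow_const (p := s)
      (Or.inl (hφ z hz).ne')
    have h2 : fderiv ℝ (smoothRpow φ hφ s : Base n × ℝ → ℝ) z = _ := h1.fderiv
    rw [dirDeriv_apply hΩ v _ hz, h2]
    change _ = (s * _) * (dirDeriv hΩ v φ : Base n × ℝ → ℝ) z
    rw [dirDeriv_apply hΩ v _ hz]
    rfl
  · have h1 := dirDeriv_apply_of_notMem hΩ v φ hz
    rw [dirDeriv_apply_of_notMem hΩ v _ hz]
    change _ = _ * (dirDeriv hΩ v φ : Base n × ℝ → ℝ) z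
    rw [h1, mul_zero]

/-- The differential algebra of a smooth solution of the graphical `H^α`-flow. Outside of `Ω` all
derivatives vanish by convention, hence so does `H`, and `0 ^ α = 0` makes the flow equation hold
there as well. -/
noncomputable def smoothFlow (hΩ : IsOpen Ω) (U : smoothOn Ω) {α : ℝ} (hα : α ≠ 0)
    (hpos : ∀ z ∈ Ω, 0 < meanCurv (U : Base n × ℝ → ℝ) z)
    (hflow : ∀ z ∈ Ω, slopeW (spaceGrad U z) * fderiv ℝ (U : Base n × ℝ → ℝ) z (timeDir n)
      = meanCurv U z ^ α) :
    FormalFlow (Fin n) (smoothOn Ω) :=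
  have hH : ∀ z ∈ Ω, 0 < ((smoothGraph hΩ U).H : Base n × ℝ → ℝ) z := fun z hz => by
    rw [smoothGraph_H_apply hΩ U hz]; exact hpos z hz
  { smoothGraph hΩ U with
    f := smoothRpow (smoothGraph hΩ U).H hH α
    f₁ := α • smoothRpow (smoothGraph hΩ U).H hH (α - 1)
    f₂ := α • (α - 1) • smoothRpow (smoothGraph hΩ U).H hH (α - 1 - 1)
    flow := by
      ext z
      change (smoothW hΩ U : Base n × ℝ → ℝ) z * (dirDeriv hΩ (timeDir n) U : Base n × ℝ → ℝ) z
        = ((smoothGraph hΩ U).H : Base n × ℝ → ℝ) z ^ α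
      by_cases hz : z ∈ Ω
      · rw [smoothGraph_H_apply hΩ U hz, ← hflow z hz, dirDeriv_apply hΩ _ _ hz]
        congr 1
        change slopeW (fun i => (dirDeriv hΩ (spaceDir i) U : Base n × ℝ → ℝ) z) = _
        congr 1
        funext i
        exact dirDeriv_apply hΩ _ U hz
      · have h0 : ((smoothGraph hΩ U).H : Base n × ℝ → ℝ) z = 0 := by
          rw [FormalGraph.H, ← evalAt_apply, map_sum]
          exact Finset.sum_eq_zero fun i _ => dirDeriv_apply_of_notMem hΩ _ _ hz
        rw [dirDeriv_apply_of_notMem hΩ _ _ hz, h0, Real.zero_rpow hα, mul_zero]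
    δ_f := fun i => dirDeriv_smoothRpow hΩ _ _ hH α
    τ_f := dirDeriv_smoothRpow hΩ _ _ hH α
    δ_f₁ := fun i => by
      change dirDeriv hΩ _ _ = _ * dirDeriv hΩ _ _
      rw [Derivation.map_smul, dirDeriv_smoothRpow]
      simp only [smul_mul_assoc] }

/-- The estimate at an interior point `z` where `ψ² |A|² - M² χ²` attains the value zero as its maximum
over nearby points of times up to that of `z`. -/
theorem curvature_le_of_isMax (hΩ : IsOpen Ω) (U : smoothOn Ω) {α c a M : ℝ} (hα : 0 < α)
    (hc : 0 < c)
    (hpos : ∀ z ∈ Ω, 0 < meanCurv (U : Base n × ℝ → ℝ) z)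
    (hflow : ∀ z ∈ Ω, slopeW (spaceGrad U z) * fderiv ℝ (U : Base n × ℝ → ℝ) z (timeDir n)
      = meanCurv U z ^ α)
    {z : Base n × ℝ} (hz : z ∈ Ω)
    (hf₁ : 2 * c ≤ meanCurv (U : Base n × ℝ → ℝ) z ^ α)
    (hf₂ : meanCurv (U : Base n × ℝ → ℝ) z ^ α ≤ 2 / c)
    (hU : (U : Base n × ℝ → ℝ) z < a) (hU0 : 0 ≤ (U : Base n × ℝ → ℝ) z)
    (hq : 0 < sqNormA (U : Base n × ℝ → ℝ) z)
    (hJ : (a - (U : Base n × ℝ → ℝ) z) ^ 2 * sqNormA (U : Base n × ℝ → ℝ) z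
      = M ^ 2 * speedWeight c (meanCurv (U : Base n × ℝ → ℝ) z ^ α) ^ 2)
    (hmax : ∀ᶠ y in 𝓝 z, y.2 ≤ z.2 → (a - (U : Base n × ℝ → ℝ) y) ^ 2 * sqNormA (U : Base n × ℝ → ℝ) y
      ≤ M ^ 2 * speedWeight c (meanCurv (U : Base n × ℝ → ℝ) y ^ α) ^ 2) :
    (a - (U : Base n × ℝ → ℝ) z) * √(sqNormA (U : Base n × ℝ → ℝ) z) ≤ threshold α c a := by
  set F := smoothFlow hΩ U hα.ne' hpos hflow with hF
  have hHz (y) (hy : y ∈ Ω) : (F.H : Base n × ℝ → ℝ) y = meanCurv U y :=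
    smoothGraph_H_apply hΩ U hy
  have hqz (y) (hy : y ∈ Ω) : (F.q : Base n × ℝ → ℝ) y = sqNormA U y :=
    smoothGraph_q_apply hΩ U hy
  have hfz (y) (hy : y ∈ Ω) : (F.f : Base n × ℝ → ℝ) y = meanCurv U y ^ α := by
    rw [← hHz y hy]; rfl
  have hf1z : (F.f₁ : Base n × ℝ → ℝ) z = α * meanCurv U z ^ (α - 1) := by
    rw [← hHz z hz]; rfl
  have hf2z : (F.f₂ : Base n × ℝ → ℝ) z = α * ((α - 1) * meanCurv U z ^ (α - 1 - 1)) := by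
    rw [← hHz z hz]; rfl
  have hψz (y) : (F.ψ a : Base n × ℝ → ℝ) y = a - (U : Base n × ℝ → ℝ) y := rfl
  have hJz (y) (hy : y ∈ Ω) : (F.J a c M : Base n × ℝ → ℝ) y
      = (a - (U : Base n × ℝ → ℝ) y) ^ 2 * sqNormA (U : Base n × ℝ → ℝ) y
        - M ^ 2 * speedWeight c (meanCurv (U : Base n × ℝ → ℝ) y ^ α) ^ 2 := by
    rw [← hfz y hy, ← hqz y hy]
    change (a - (U : Base n × ℝ → ℝ) y) * (a - (U : Base n × ℝ → ℝ) y) * (F.q : Base n × ℝ → ℝ) y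
      - M ^ 2 * (((F.f : Base n × ℝ → ℝ) y - c
        - c ^ 3 / 8 * ((F.f : Base n × ℝ → ℝ) y * (F.f : Base n × ℝ → ℝ) y))
       * ((F.f : Base n × ℝ → ℝ) y - c
        - c ^ 3 / 8 * ((F.f : Base n × ℝ → ℝ) y * (F.f : Base n × ℝ → ℝ) y))) = _
    rw [speedWeight]; ring
  have hJ0 : (F.J a c M : Base n × ℝ → ℝ) z = 0 := by rw [hJz z hz, hJ, sub_self]
  have hHpos := hpos z hz
  have hJmax : ∀ᶠ y in 𝓝 z, y.2 ≤ z.2 → (F.J a c M : Base n × ℝ → ℝ) y ≤ (F.J a c M : Base n × ℝ → ℝ) z := by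
    filter_upwards [hmax, hΩ.mem_nhds hz] with y hy hyΩ hyt
    rw [hJ0, hJz y hyΩ]
    linarith [hy hyt]
  have hline (v : Base n × ℝ) : Filter.Tendsto (fun s : ℝ => z + s • v) (𝓝 0) (𝓝 z) := by
    have : Continuous fun s : ℝ => z + s • v := by fun_prop
    simpa using this.tendsto 0
  have hspace (v : Base n × ℝ) (hv : v.2 = 0) :
      IsLocalMax (fun s : ℝ => (F.J a c M : Base n × ℝ → ℝ) (z + s • v)) 0 := by
    filter_upwards [(hline v).eventually hJmax] with s hs
    simpa using hs (by simp [hv])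
  have hsmooth := smoothOn.contDiffAt hΩ (F.J a c M) hz
  have hdiff := smoothOn.differentiableAt hΩ (F.J a c M) hz
  have hδJ (i : Fin n) : evalAt Ω z (F.δ i (F.J a c M)) = 0 := by
    rw [evalAt_apply]
    exact (dirDeriv_apply hΩ (spaceDir i) _ hz).trans
      (fderiv_eq_zero_of_isLocalMax_line hdiff (hspace _ rfl))
  have hτJ : 0 ≤ evalAt Ω z (F.τ (F.J a c M)) := by
    rw [evalAt_apply]
    refine le_of_le_of_eq (fderiv_nonneg_of_le_before (v := timeDir n) hdiff ?_)
      (dirDeriv_apply hΩ (timeDir n) _ hz).symm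
    filter_upwards [((hline (timeDir n)).mono_left nhdsWithin_le_nhds).eventually hJmax,
      self_mem_nhdsWithin] with s hs hs0
    refine hs ?_
    have : s < 0 := hs0
    simp [timeDir, this.le]
  have hΔJ : ∑ i, ∑ j, evalAt Ω z (F.P i j) * evalAt Ω z (F.δ i (F.δ j (F.J a c M))) ≤ 0 := by
    obtain ⟨L, hL⟩ := F.exists_frame (evalAt Ω z)
    have h1 (i j : Fin n) : evalAt Ω z (F.δ i (F.δ j (F.J a c M)))
        = fderiv ℝ (fderiv ℝ (F.J a c M : Base n × ℝ → ℝ)) z (spaceDir i) (spaceDir j) :=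
      dirDeriv_dirDeriv_apply hΩ _ _ _ hz
    simp only [h1]
    rw [F.sum_P_mul_frame (evalAt Ω z) hL]
    refine Finset.sum_nonpos fun a' _ => ?_
    have h2 := fderiv_fderiv_nonpos_of_isLocalMax_line hsmooth
      (hspace (∑ i, L i a' • spaceDir i) (by simp [Prod.snd_sum, spaceDir]))
    refine le_of_eq_of_le ?_ h2
    simp only [map_sum, map_smul, sum_apply, smul_apply,
      smul_eq_mul, Finset.mul_sum]
    rw [Finset.sum_comm]
    exact Finset.sum_congr rfl fun i _ => Finset.sum_congr rfl fun j _ => by ring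
  have hLJ : 0 ≤ evalAt Ω z (F.L (F.J a c M)) := by
    simp only [FormalFlow.L, map_sub, map_add, map_mul, map_sum, hδJ, mul_zero,
      Finset.sum_const_zero, add_zero]
    have hf1 : 0 ≤ evalAt Ω z F.f₁ := by
      rw [evalAt_apply, hf1z]; positivity
    have := mul_nonpos_of_nonneg_of_nonpos hf1 hΔJ
    linarith
  have key := F.ev_curvature_le (evalAt Ω z) (α := α) (c := c) (a := a) (M := M) hα hc
    (by rw [evalAt_apply, hfz z hz]; exact hf₁) (by rw [evalAt_apply, hfz z hz]; exact hf₂)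
    (by rw [evalAt_apply, hHz z hz]; exact hHpos)
    (by rw [evalAt_apply, evalAt_apply, hHz z hz, hfz z hz])
    (by
      rw [evalAt_apply, evalAt_apply, evalAt_apply, hHz z hz, hfz z hz, hf1z, mul_assoc,
        Real.rpow_sub_one hHpos.ne', div_mul_cancel₀ _ hHpos.ne'])
    (by
      rw [evalAt_apply, evalAt_apply, evalAt_apply, hHz z hz, hf1z, hf2z,
        Real.rpow_sub_one hHpos.ne' (α - 1)]
      field_simp)
    (by rw [evalAt_apply, hqz z hz]; exact hq)
    (by rw [evalAt_apply, hψz]; linarith) (by rw [evalAt_apply, hψz]; linarith) hJ0 hδJ hLJ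
  rwa [evalAt_apply, evalAt_apply, hψz, hqz z hz] at key

end SmoothFlow

/-! ### Regularity, monotonicity and compactness for a graphical flow -/

namespace IsGraphicalFlowBelow

variable {n : ℕ} {α a : ℝ} {T : EReal} {u : Base n → ℝ → EReal}

/-- The height function on space-time; it is only used where it is finite. -/
def height (u : Base n → ℝ → EReal) (p : Base n × ℝ) : ℝ := slice u p.2 p.1

lemma coe_height (hu : IsGraphicalFlowBelow α a T u) {b : ℝ} {p : Base n × ℝ}
    (hp : p ∈ belowHeight T u b) : (height u p : EReal) = u p.1 p.2 :=
  EReal.coe_toReal (hp.2.trans (EReal.coe_lt_top b)).ne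
    (EReal.bot_lt_zero.trans_le (hu.nonneg _ hp.1 _)).ne'

lemma height_nonneg (hu : IsGraphicalFlowBelow α a T u) {b : ℝ} {p : Base n × ℝ}
    (hp : p ∈ belowHeight T u b) : 0 ≤ height u p := by
  have := hu.nonneg _ hp.1 p.1
  rw [← coe_height hu hp] at this
  exact_mod_cast this

lemma continuousOn_height (hu : IsGraphicalFlowBelow α a T u) {b : ℝ} :
    ContinuousOn (height u) (belowHeight T u b) := by
  refine EReal.continuousOn_toReal.comp
    (hu.continuousOn.mono fun p hp => ⟨Set.mem_univ _, hp.1⟩) fun p hp => ?_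
  have h := coe_height hu hp
  change u p.1 p.2 ∈ ({⊥, ⊤}ᶜ : Set EReal)
  rw [← h]
  simp

lemma isOpen_positive_times (T : EReal) :
    IsOpen {p : Base n × ℝ | 0 < p.2 ∧ (p.2 : EReal) < T} :=
  (isOpen_lt continuous_const continuous_snd).inter
    (isOpen_lt (continuous_coe_real_ereal.comp continuous_snd) continuous_const)

lemma isOpen_belowHeight (hu : IsGraphicalFlowBelow α a T u) (b : ℝ) :
    IsOpen (belowHeight T u b ∩ {p | 0 < p.2}) := by
  have h := (hu.continuousOn.mono (fun p (hp : 0 < p.2 ∧ (p.2 : EReal) < T) =>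
    ⟨Set.mem_univ p.1, hp.1.le, hp.2⟩)).isOpen_inter_preimage (isOpen_positive_times T)
    (isOpen_Iio (a := (b : EReal)))
  convert h using 1
  ext p
  simp only [belowHeight, timeInterval, Set.mem_inter_iff, Set.mem_ofPred_eq]
  constructor
  · rintro ⟨⟨⟨-, h1⟩, h2⟩, h3⟩
    exact ⟨⟨h3, h1⟩, h2⟩
  · rintro ⟨⟨h3, h1⟩, h2⟩
    exact ⟨⟨⟨h3.le, h1⟩, h2⟩, h3⟩

/-- The open set of positive times and heights below `a + 1`, where the flow is smooth. -/
abbrev region (a : ℝ) (T : EReal) (u : Base n → ℝ → EReal) : Set (Base n × ℝ) :=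
  belowHeight T u (a + 1) ∩ {p | 0 < p.2}

lemma isOpen_region (hu : IsGraphicalFlowBelow α a T u) : IsOpen (region a T u) :=
  isOpen_belowHeight hu (a + 1)

lemma contDiffAt_height (hu : IsGraphicalFlowBelow α a T u) {p : Base n × ℝ}
    (hp : p ∈ region a T u) : ContDiffAt ℝ ∞ (height u) p :=
  ContDiffOn.contDiffAt hu.smooth ((isOpen_region hu).mem_nhds hp)

lemma contDiffAt_slice (hu : IsGraphicalFlowBelow α a T u) {p : Base n × ℝ}
    (hp : p ∈ belowHeight T u (a + 1)) : ContDiffAt ℝ 2 (slice u p.2) p.1 := by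
  rcases hp.1.1.eq_or_lt with h0 | h0
  · rw [← h0]
    have hp2 := hp.2
    rw [← h0] at hp2
    refine hu.initial_regular.contDiffAt (IsOpen.mem_nhds ?_ hp2)
    have : Continuous fun x => u x 0 := by
      have h := hu.continuousOn.comp_continuous (f := fun x : Base n => (x, (0 : ℝ)))
        (by fun_prop) (fun x => ⟨Set.mem_univ _, le_rfl, by simpa using hu.T_pos⟩)
      exact h
    exact isOpen_Iio.preimage this
  · have h1 : ContDiffAt ℝ 2 (height u) (p.1, p.2) :=
      (contDiffAt_height hu ⟨hp, h0⟩).of_le ENat.LEInfty.out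
    exact h1.comp (f := fun x : Base n => (x, p.2)) p.1 (by fun_prop)

lemma fderiv_slice (hu : IsGraphicalFlowBelow α a T u) {p : Base n × ℝ}
    (hp : p ∈ region a T u) (v : Base n) :
    fderiv ℝ (slice u p.2) p.1 v = fderiv ℝ (height u) p (v, 0) := by
  have h1 : HasFDerivAt (height u) (fderiv ℝ (height u) p) (p.1, p.2) :=
    ((contDiffAt_height hu hp).differentiableAt (by simp)).hasFDerivAt
  have h2 : HasFDerivAt (fun x : Base n => height u (x, p.2)) _ p.1 :=
    h1.comp (f := fun x : Base n => (x, p.2)) p.1 (hasFDerivAt_prodMk_left p.1 p.2)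
  have h3 : fderiv ℝ (slice u p.2) p.1 = _ := h2.fderiv
  rw [h3]
  simp

lemma grad_slice (hu : IsGraphicalFlowBelow α a T u) {p : Base n × ℝ}
    (hp : p ∈ region a T u) : grad (slice u p.2) p.1 = spaceGrad (height u) p := by
  funext i
  exact fderiv_slice hu hp _

lemma hess_slice (hu : IsGraphicalFlowBelow α a T u) {p : Base n × ℝ}
    (hp : p ∈ region a T u) : hess (slice u p.2) p.1 = spaceHess (height u) p := by
  funext i j
  have hcont : Continuous fun x : Base n => (x, p.2) := by fun_prop
  have h0 : ∀ᶠ x in 𝓝 p.1, (x, p.2) ∈ region a T u :=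
    hcont.continuousAt.eventually ((isOpen_region hu).mem_nhds hp)
  have h1 : (fun x => fderiv ℝ (slice u p.2) x (EuclideanSpace.single i 1))
      =ᶠ[𝓝 p.1] fun x => fderiv ℝ (height u) (x, p.2) (spaceDir i) := by
    filter_upwards [h0] with x hx
    exact fderiv_slice hu hx _
  have h2 : DifferentiableAt ℝ (fderiv ℝ (slice u p.2)) p.1 :=
    ((contDiffAt_slice hu hp.1).fderiv_right (m := 1)
      (by rw [one_add_one_eq_two])).differentiableAt (by simp)
  have h3 : HasFDerivAt (fderiv ℝ (height u)) (fderiv ℝ (fderiv ℝ (height u)) p) (p.1, p.2) :=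
    (((contDiffAt_height hu hp).fderiv_right (m := 1)
      (by rw [one_add_one_eq_two]; exact ENat.LEInfty.out)).differentiableAt (by simp)).hasFDerivAt
  have h4 : HasFDerivAt (fun x : Base n => fderiv ℝ (height u) (x, p.2)) _ p.1 :=
    h3.comp (f := fun x : Base n => (x, p.2)) p.1 (hasFDerivAt_prodMk_left p.1 p.2)
  have h5 := h2.hasFDerivAt.clm_apply
    (hasFDerivAt_const (EuclideanSpace.single i (1 : ℝ) : Base n) p.1)
  have h6 := h4.clm_apply (hasFDerivAt_const (spaceDir i : Base n × ℝ) p.1)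
  have h7 := h1.fderiv_eq (𝕜 := ℝ)
  rw [h5.fderiv, h6.fderiv] at h7
  have h8 := congrArg (fun l : Base n →L[ℝ] ℝ => l (EuclideanSpace.single j 1)) h7
  simpa [hess, spaceHess, spaceDir] using h8

/-- The mean curvature in terms of the derivatives of the time slice. -/
noncomputable def sliceH (u : Base n → ℝ → EReal) (p : Base n × ℝ) : ℝ :=
  ∑ i, shape (grad (slice u p.2) p.1) (hess (slice u p.2) p.1) i i

/-- The squared norm `|A|²` in terms of the derivatives of the time slice. -/
noncomputable def sliceSqA (u : Base n → ℝ → EReal) (p : Base n × ℝ) : ℝ :=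
  ∑ i, ∑ j, shape (grad (slice u p.2) p.1) (hess (slice u p.2) p.1) i j
    * shape (grad (slice u p.2) p.1) (hess (slice u p.2) p.1) j i

lemma graphH_slice (hu : IsGraphicalFlowBelow α a T u) {p : Base n × ℝ}
    (hp : p ∈ belowHeight T u (a + 1)) : graphH (slice u p.2) p.1 = sliceH u p :=
  graphH_eq (contDiffAt_slice hu hp)

lemma graphA_slice (hu : IsGraphicalFlowBelow α a T u) {p : Base n × ℝ}
    (hp : p ∈ belowHeight T u (a + 1)) : graphA (slice u p.2) p.1 = √(sliceSqA u p) :=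
  graphA_eq (contDiffAt_slice hu hp)

lemma sliceH_eq (hu : IsGraphicalFlowBelow α a T u) {p : Base n × ℝ}
    (hp : p ∈ region a T u) : sliceH u p = meanCurv (height u) p := by
  rw [sliceH, meanCurv, grad_slice hu hp, hess_slice hu hp]

lemma sliceSqA_eq (hu : IsGraphicalFlowBelow α a T u) {p : Base n × ℝ}
    (hp : p ∈ region a T u) : sliceSqA u p = sqNormA (height u) p := by
  rw [sliceSqA, sqNormA, grad_slice hu hp, hess_slice hu hp]

lemma continuousOn_shape_slice (hu : IsGraphicalFlowBelow α a T u) (i j : Fin n) :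
    ContinuousOn (fun p : Base n × ℝ => shape (grad (slice u p.2) p.1) (hess (slice u p.2) p.1) i j)
      (belowHeight T u (a + 1)) := by
  have h1 (k : Fin n) : ContinuousOn (fun p : Base n × ℝ =>
      fderiv ℝ (slice u p.2) p.1 (EuclideanSpace.single k (1 : ℝ))) (belowHeight T u (a + 1)) :=
    hu.continuousOn_fderiv.clm_apply continuousOn_const
  have h2 (k : Fin n) : ContinuousOn (fun p : Base n × ℝ =>
      fderiv ℝ (fderiv ℝ (slice u p.2)) p.1 (EuclideanSpace.single k (1 : ℝ)))
      (belowHeight T u (a + 1)) := hu.continuousOn_fderiv_fderiv.clm_apply continuousOn_const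
  have h3 (k l : Fin n) : ContinuousOn (fun p : Base n × ℝ =>
      fderiv ℝ (fderiv ℝ (slice u p.2)) p.1 (EuclideanSpace.single k (1 : ℝ))
        (EuclideanSpace.single l (1 : ℝ))) (belowHeight T u (a + 1)) :=
    (h2 k).clm_apply continuousOn_const
  have h4 : ContinuousOn (fun p : Base n × ℝ => grad (slice u p.2) p.1)
      (belowHeight T u (a + 1)) := continuousOn_pi.mpr h1
  have h5 : ContinuousOn (fun p : Base n × ℝ => hess (slice u p.2) p.1)
      (belowHeight T u (a + 1)) :=
    continuousOn_pi.mpr fun k => continuousOn_pi.mpr fun l => h3 l k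
  have h6 := (continuous_shape i j).comp_continuousOn (h4.prodMk h5)
  exact h6

lemma continuousOn_sliceH (hu : IsGraphicalFlowBelow α a T u) :
    ContinuousOn (sliceH u) (belowHeight T u (a + 1)) :=
  continuousOn_finsetSum _ fun i _ => continuousOn_shape_slice hu i i

lemma continuousOn_sliceSqA (hu : IsGraphicalFlowBelow α a T u) :
    ContinuousOn (sliceSqA u) (belowHeight T u (a + 1)) :=
  continuousOn_finsetSum _ fun i _ => continuousOn_finsetSum _ fun j _ =>
    (continuousOn_shape_slice hu i j).mul (continuousOn_shape_slice hu j i)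

lemma sliceH_pos (hu : IsGraphicalFlowBelow α a T u) {p : Base n × ℝ}
    (hp : p ∈ belowHeight T u (a + 1)) : 0 < sliceH u p := by
  rw [← graphH_slice hu hp]; exact hu.meanConvex p hp

lemma slopeW_pos (d : Fin n → ℝ) : 0 < slopeW d := by
  have : 0 ≤ ∑ i, d i ^ 2 := Finset.sum_nonneg fun _ _ => sq_nonneg _
  exact inv_pos.mpr (Real.sqrt_pos.mpr (by linarith))

lemma hasDerivAt_height (hu : IsGraphicalFlowBelow α a T u) {p : Base n × ℝ}
    (hp : p ∈ region a T u) :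
    HasDerivAt (fun s => slice u s p.1) (fderiv ℝ (height u) p (timeDir n)) p.2 := by
  have h1 : HasFDerivAt (height u) (fderiv ℝ (height u) p) (p.1, p.2) :=
    ((contDiffAt_height hu hp).differentiableAt (by simp)).hasFDerivAt
  exact h1.comp_hasDerivAt p.2 ((hasDerivAt_const p.2 p.1).prodMk (hasDerivAt_id p.2))

lemma flow_eq (hu : IsGraphicalFlowBelow α a T u) {p : Base n × ℝ} (hp : p ∈ region a T u) :
    slopeW (spaceGrad (height u) p) * fderiv ℝ (height u) p (timeDir n)
      = meanCurv (height u) p ^ α := by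
  have h1 := hu.flow p hp.1 hp.2
  have h2 : HasDerivAt (fun s => graphMap (slice u s) p.1)
      (pointL n (0, fderiv ℝ (height u) p (timeDir n))) p.2 :=
    (pointL n).hasFDerivAt.comp_hasDerivAt p.2
      ((hasDerivAt_const p.2 p.1).prodMk (hasDerivAt_height hu hp))
  rw [h2.deriv, pointL_apply, inner_point_zero_graphNormal, grad_slice hu hp,
    graphH_slice hu hp.1, sliceH_eq hu hp] at h1
  exact h1

lemma deriv_height_pos (hu : IsGraphicalFlowBelow α a T u) {p : Base n × ℝ}
    (hp : p ∈ region a T u) : 0 < fderiv ℝ (height u) p (timeDir n) := by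
  have h1 := flow_eq hu hp
  have h2 : 0 < meanCurv (height u) p ^ α := by
    rw [← sliceH_eq hu hp]; exact Real.rpow_pos_of_pos (sliceH_pos hu hp.1) α
  rw [← h1] at h2
  exact (pos_iff_pos_of_mul_pos h2).mp (slopeW_pos _)

/-- The height is nondecreasing in time as long as it is less than `a + 1`. Backward in time from `t`
the height stays below `u x t`, so it never leaves the region where its time derivative is
positive. -/
lemma le_of_le_time (hu : IsGraphicalFlowBelow α a T u) {x : Base n} {s t : ℝ}
    (ht : t ∈ timeInterval T) (hs0 : 0 ≤ s) (hst : s ≤ t) (hx : u x t < ((a + 1 : ℝ) : EReal)) :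
    u x s ≤ u x t := by
  have hI {r : ℝ} (hr : r ∈ Set.Icc 0 t) : r ∈ timeInterval T :=
    ⟨hr.1, lt_of_le_of_lt (EReal.coe_le_coe_iff.mpr hr.2) ht.2⟩
  have hc : ContinuousOn (fun r => u x r) (Set.Icc 0 t) :=
    hu.continuousOn.comp (f := fun r : ℝ => (x, r)) (by fun_prop) fun r hr => ⟨Set.mem_univ _, hI hr⟩
  have hclosed : IsClosed ({r | u x r ≤ u x t} ∩ Set.Icc 0 t) := by
    rw [Set.inter_comm]
    exact hc.preimage_isClosed_of_isClosed isClosed_Icc isClosed_Iic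
  refine hclosed.Icc_subset_of_forall_exists_lt (le_refl (u x t)) ?_ ⟨hs0, hst⟩
  rintro r ⟨hr, hr0⟩ y hy
  have hrt : (x, r) ∈ region a T u :=
    ⟨⟨hI ⟨hr0.1.le, hr0.2⟩, lt_of_le_of_lt hr hx⟩, hr0.1⟩
  have hcr : Continuous fun r : ℝ => (x, r) := by fun_prop
  have hnhds : ∀ᶠ r' in 𝓝 r, (x, r') ∈ region a T u :=
    hcr.continuousAt.eventually ((isOpen_region hu).mem_nhds hrt)
  obtain ⟨ε, hε, hball⟩ := Metric.eventually_nhds_iff.mp hnhds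
  -- a short time interval before `r` on which the height is monotone
  set r' := max y (r - ε / 2)
  have hr'r : r' < r := max_lt hy (by linarith)
  have hmem {v : ℝ} (hv : v ∈ Set.Icc r' r) : (x, v) ∈ region a T u := by
    refine hball ?_
    rw [Real.dist_eq, abs_lt]
    have : r - ε / 2 ≤ r' := le_max_right _ _
    constructor <;> linarith [hv.1, hv.2]
  have hder {v : ℝ} (hv : v ∈ Set.Icc r' r) := hasDerivAt_height hu (hmem hv)
  have hmono : MonotoneOn (fun v => slice u v x) (Set.Icc r' r) := by
    refine monotoneOn_of_deriv_nonneg (convex_Icc _ _)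
      (fun v hv => (hder hv).continuousAt.continuousWithinAt)
      (fun v hv => (hder (interior_subset hv)).differentiableAt.differentiableWithinAt)
      fun v hv => ?_
    rw [(hder (interior_subset hv)).deriv]
    exact (deriv_height_pos hu (hmem (interior_subset hv))).le
  refine ⟨r', ?_, le_max_left _ _, hr'r⟩
  have hl : r' ∈ Set.Icc r' r := ⟨le_rfl, hr'r.le⟩
  have hrr : r ∈ Set.Icc r' r := ⟨hr'r.le, le_rfl⟩
  have h := hmono hl hrr hr'r.le
  have e1 := coe_height hu (hmem hl).1
  have e2 := coe_height hu (hmem hrr).1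
  change _ = u x r' at e1
  change _ = u x r at e2
  have hr2 : u x r ≤ u x t := hr
  change u x r' ≤ u x t
  refine le_trans ?_ hr2
  rw [← e1, ← e2]
  exact_mod_cast h

/-- The points of height at most `a` and time at most `t₁`. -/
def below (a t₁ : ℝ) (u : Base n → ℝ → EReal) : Set (Base n × ℝ) :=
  {p | p.2 ∈ Set.Icc 0 t₁ ∧ u p.1 p.2 ≤ a}

lemma lt_add_one_of_le {y : EReal} (h : y ≤ (a : EReal)) : y < ((a + 1 : ℝ) : EReal) :=
  lt_of_le_of_lt h (EReal.coe_lt_coe_iff.mpr (lt_add_one a))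

lemma isCompact_below (hu : IsGraphicalFlowBelow α a T u) {t₁ : ℝ} (ht₁ : t₁ ∈ timeInterval T) :
    IsCompact (below a t₁ u) := by
  have h0 : (0 : ℝ) ∈ timeInterval T := ⟨le_rfl, by simpa using hu.T_pos⟩
  have hI {r : ℝ} (hr : r ∈ Set.Icc 0 t₁) : r ∈ timeInterval T :=
    ⟨hr.1, lt_of_le_of_lt (EReal.coe_le_coe_iff.mpr hr.2) ht₁.2⟩
  refine ((hu.isCompact_sublevel 0 h0).prod (isCompact_Icc (a := 0) (b := t₁))).of_isClosed_subset
    ?_ ?_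
  · have hc : ContinuousOn (fun p : Base n × ℝ => u p.1 p.2) (Set.univ ×ˢ Set.Icc 0 t₁) :=
      hu.continuousOn.mono fun p hp => ⟨hp.1, hI hp.2⟩
    have := hc.preimage_isClosed_of_isClosed (isClosed_univ.prod isClosed_Icc)
      (isClosed_Iic (a := (a : EReal)))
    convert this using 1
    ext p
    simp [below]
  · rintro p ⟨hp1, hp2⟩
    exact ⟨(le_of_le_time hu (hI hp1) le_rfl hp1.1 (lt_add_one_of_le hp2)).trans hp2, hp1⟩

lemma below_subset {t₁ : ℝ} (ht₁ : t₁ ∈ timeInterval T) :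
    below a t₁ u ⊆ belowHeight T u (a + 1) := fun _ hp =>
  ⟨⟨hp.1.1, lt_of_le_of_lt (EReal.coe_le_coe_iff.mpr hp.1.2) ht₁.2⟩, lt_add_one_of_le hp.2⟩

lemma cutoff_of_le (hu : IsGraphicalFlowBelow α a T u) {b : ℝ} {p : Base n × ℝ}
    (hp : p ∈ belowHeight T u b) (hpa : u p.1 p.2 ≤ a) :
    cutoff u a p.1 p.2 = a - height u p := by
  rw [cutoff, ← coe_height hu hp, ← EReal.coe_sub, max_eq_left, EReal.toReal_coe]
  rw [← coe_height hu hp] at hpa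
  have : height u p ≤ a := by exact_mod_cast hpa
  exact_mod_cast sub_nonneg.mpr this

lemma cutoff_of_not_lt {x : Base n} {t : ℝ} (h : ¬ u x t < a) : cutoff u a x t = 0 := by
  rw [cutoff, max_eq_right, EReal.toReal_zero]
  exact EReal.sub_nonpos.mpr (not_lt.mp h)

lemma cutoff_nonneg (x : Base n) (t : ℝ) : 0 ≤ cutoff u a x t :=
  EReal.toReal_nonneg (le_max_right _ _)

lemma bddAbove_initial (hu : IsGraphicalFlowBelow α a T u) :
    BddAbove (Set.range fun y : Base n => cutoff u a y 0 * graphA (slice u 0) y) := by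
  have h0 : (0 : ℝ) ∈ timeInterval T := ⟨le_rfl, by simpa using hu.T_pos⟩
  have hsub := below_subset (a := a) (u := u) h0
  obtain ⟨m, hm⟩ := ((isCompact_below hu h0).image_of_continuousOn
    (((continuousOn_const (c := a)).sub (continuousOn_height hu)).mul
      (continuousOn_sliceSqA hu).sqrt |>.mono hsub)).bddAbove
  refine ⟨max m 0, ?_⟩
  rintro _ ⟨y, rfl⟩
  by_cases hy : u y 0 < a
  · have hmem : (y, (0 : ℝ)) ∈ below a 0 u := ⟨⟨le_rfl, le_rfl⟩, hy.le⟩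
    have h1 := hm (Set.mem_image_of_mem _ hmem)
    refine le_max_of_le_left ?_
    change cutoff u a (y, (0 : ℝ)).1 (y, (0 : ℝ)).2
      * graphA (slice u (y, (0 : ℝ)).2) (y, (0 : ℝ)).1 ≤ m
    rw [cutoff_of_le hu (hsub hmem) hy.le, graphA_slice hu (hsub hmem)]
    exact h1
  · simp [cutoff_of_not_lt hy]

end IsGraphicalFlowBelow

namespace IsGraphicalFlowBelow

variable {n : ℕ} {α a : ℝ} {T : EReal} {u : Base n → ℝ → EReal}

/-! ### The curvature estimate -/

/-- The maximum principle for `ψ|A| / max(χ, c/2)` on the compact set of points of height at most `a`.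
The maximum with `c/2` is `χ` where the height is less than `a`. It keeps the denominator positive
also at height `a`, where the bounds for the speed are not assumed. -/
lemma curvature_estimate (hu : IsGraphicalFlowBelow α a T u) {c : ℝ} (hα : 0 < α) (hc : 0 < c)
    (hH : ∀ p ∈ belowHeight T u a, c ≤ 1 / 2 * graphH (slice u p.2) p.1 ^ α ∧
      1 / 2 * graphH (slice u p.2) p.1 ^ α ≤ c⁻¹)
    {I : ℝ} (hI : ∀ y : Base n, cutoff u a y 0 * graphA (slice u 0) y ≤ I)
    {t : ℝ} (ht : t ∈ timeInterval T) (x : Base n) :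
    cutoff u a x t * graphA (slice u t) x ≤ 4 / c ^ 2 * threshold α c a * max I 1 := by
  have hth := one_le_threshold (a := a) hα hc
  have hth0 : 0 < threshold α c a := by linarith
  have hR0 : 0 ≤ 4 / c ^ 2 * threshold α c a * max I 1 := by
    have : 0 < max I 1 := lt_max_of_lt_right one_pos
    positivity
  by_cases hx : u x t < a
  swap
  · rw [cutoff_of_not_lt hx, zero_mul]; exact hR0
  set K := below a t u
  have hK : IsCompact K := isCompact_below hu ht
  have hsub : K ⊆ belowHeight T u (a + 1) := below_subset ht
  have hxK : (x, t) ∈ K := ⟨⟨ht.1, le_rfl⟩, hx.le⟩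
  have hbase {p : Base n × ℝ} (hp : p ∈ K) (hpa : u p.1 p.2 < a) : p ∈ belowHeight T u a :=
    ⟨(hsub hp).1, hpa⟩
  have hmc {p : Base n × ℝ} (hp : p ∈ belowHeight T u (a + 1)) (hpa : u p.1 p.2 < a) :
      2 * c ≤ sliceH u p ^ α ∧ sliceH u p ^ α ≤ 2 / c := by
    have h := hH p ⟨hp.1, hpa⟩
    rw [graphH_slice hu hp] at h
    rw [div_eq_mul_inv]
    constructor <;> linarith [h.1, h.2]
  set χ : Base n × ℝ → ℝ := fun p => max (speedWeight c (sliceH u p ^ α)) (c / 2) with hχ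
  have hχpos (p) : 0 < χ p := lt_max_of_lt_right (by positivity)
  have hχeq {p : Base n × ℝ} (hp : p ∈ belowHeight T u (a + 1)) (hpa : u p.1 p.2 < a) :
      χ p = speedWeight c (sliceH u p ^ α) :=
    max_eq_left (speedWeight_bounds hc (hmc hp hpa).1 (hmc hp hpa).2).1
  set N : Base n × ℝ → ℝ := fun p => (a - height u p) * √(sliceSqA u p) with hN
  have hNeq {p : Base n × ℝ} (hp : p ∈ K) :
      cutoff u a p.1 p.2 * graphA (slice u p.2) p.1 = N p := by
    rw [cutoff_of_le hu (hsub hp) hp.2, graphA_slice hu (hsub hp)]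
  have hcont : ContinuousOn (fun p => N p / χ p) K := by
    have h1 : ContinuousOn N K :=
      ((continuousOn_const.sub (continuousOn_height hu)).mul (continuousOn_sliceSqA hu).sqrt).mono hsub
    have h2 : ContinuousOn (fun p => sliceH u p ^ α) K :=
      ((continuousOn_sliceH hu).mono hsub).rpow_const fun p hp => Or.inl (sliceH_pos hu (hsub hp)).ne'
    have h3 : Continuous (speedWeight c) := by unfold speedWeight; fun_prop
    exact h1.div ((h3.comp_continuousOn h2).sup continuousOn_const) fun p _ => (hχpos p).ne'
  obtain ⟨z, hzK, hzmax⟩ := hK.exists_isMaxOn ⟨_, hxK⟩ hcont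
  set M := N z / χ z with hM
  have hle {p : Base n × ℝ} (hp : p ∈ K) : N p ≤ M * χ p := by
    rw [← div_le_iff₀ (hχpos p)]; exact hzmax hp
  have hNz : N z = M * χ z := by rw [hM, div_mul_cancel₀ _ (hχpos z).ne']
  have hN0 {p : Base n × ℝ} (hp : p ∈ K) : 0 ≤ N p := by
    rw [← hNeq hp]; exact mul_nonneg (cutoff_nonneg _ _) (Real.sqrt_nonneg _)
  have hM0 : 0 ≤ M := div_nonneg (hN0 hzK) (hχpos z).le
  -- the maximal value of `ψ |A|` is controlled at the point where the quotient is maximal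
  have hNzle : N z ≤ threshold α c a * max I 1 := by
    rcases hzK.1.1.eq_or_lt with h0 | h0
    · have h1 : N z ≤ I := by
        rw [← hNeq hzK, ← h0]; exact hI _
      calc N z ≤ max I 1 := h1.trans (le_max_left _ _)
        _ ≤ _ := le_mul_of_one_le_left (le_max_of_le_right zero_le_one) hth
    · rcases hM0.eq_or_lt with hM1 | hM1
      · rw [hNz, ← hM1, zero_mul]
        exact mul_nonneg hth0.le (le_max_of_le_right zero_le_one)
      · have hNpos : 0 < N z := by rw [hNz]; exact mul_pos hM1 (hχpos z)
        have hψ0 : 0 < a - height u z := by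
          by_contra! hneg
          exact absurd hNpos (not_lt.mpr (mul_nonpos_of_nonpos_of_nonneg hneg (Real.sqrt_nonneg _)))
        have hza : u z.1 z.2 < a := by
          rw [← coe_height hu (hsub hzK)]
          exact_mod_cast sub_pos.mp hψ0
        have hzr : z ∈ region a T u := ⟨hsub hzK, h0⟩
        have hsq : 0 < sliceSqA u z := by
          have : 0 < √(sliceSqA u z) := (pos_iff_pos_of_mul_pos hNpos).mp hψ0
          exact Real.sqrt_pos.mp this
        have hNsq {p : Base n × ℝ} (hp : 0 ≤ sliceSqA u p) :
            (a - height u p) ^ 2 * sliceSqA u p = N p ^ 2 := by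
          rw [hN, mul_pow, Real.sq_sqrt hp]
        let U : smoothOn (region a T u) := ⟨height u, hu.smooth⟩
        have key := curvature_le_of_isMax (isOpen_region hu) U (α := α) (c := c) (a := a) (M := M)
          hα hc (fun p hp => by
            change 0 < meanCurv (height u) p
            rw [← sliceH_eq hu hp]; exact sliceH_pos hu hp.1)
          (fun p hp => flow_eq hu hp) hzr
          (by
            change 2 * c ≤ meanCurv (height u) z ^ α
            rw [← sliceH_eq hu hzr]; exact (hmc hzr.1 hza).1)
          (by
            change meanCurv (height u) z ^ α ≤ 2 / c
            rw [← sliceH_eq hu hzr]; exact (hmc hzr.1 hza).2)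
          (sub_pos.mp hψ0) (height_nonneg hu hzr.1)
          (by
            change 0 < sqNormA (height u) z
            rw [← sliceSqA_eq hu hzr]; exact hsq)
          (by
            change (a - height u z) ^ 2 * sqNormA (height u) z
              = M ^ 2 * speedWeight c (meanCurv (height u) z ^ α) ^ 2
            rw [← sliceSqA_eq hu hzr, ← sliceH_eq hu hzr, hNsq hsq.le, hNz, hχeq hzr.1 hza, mul_pow])
          (by
            filter_upwards [(isOpen_belowHeight hu a).mem_nhds ⟨⟨hzr.1.1, hza⟩, h0⟩] with y hy hyz
            change (a - height u y) ^ 2 * sqNormA (height u) y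
              ≤ M ^ 2 * speedWeight c (meanCurv (height u) y ^ α) ^ 2
            have hyK : y ∈ K := ⟨⟨hy.2.le, hyz.trans hzK.1.2⟩, hy.1.2.le⟩
            have hyr : y ∈ region a T u := ⟨hsub hyK, hy.2⟩
            rw [← sliceSqA_eq hu hyr, ← sliceH_eq hu hyr, ← hχeq hyr.1 hy.1.2, ← mul_pow]
            rcases le_or_gt 0 (sliceSqA u y) with hs | hs
            · rw [hNsq hs]
              exact pow_le_pow_left₀ (hN0 hyK) (hle hyK) 2
            · exact (mul_nonpos_of_nonneg_of_nonpos (sq_nonneg _) hs.le).trans (sq_nonneg _))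
        have key' : N z ≤ threshold α c a := by
          rw [hN]
          simp only
          rw [sliceSqA_eq hu hzr]
          exact key
        exact key'.trans (le_mul_of_one_le_right hth0.le (le_max_right _ _))
  have hMle : M ≤ 2 / c * (threshold α c a * max I 1) := by
    have h1 : M * (c / 2) ≤ M * χ z := mul_le_mul_of_nonneg_left (le_max_right _ _) hM0
    have h2 : M * (c / 2) ≤ threshold α c a * max I 1 := by rw [← hNz] at h1; linarith
    have h3 : M = 2 / c * (M * (c / 2)) := by field_simp
    rw [h3]
    gcongr
  have hχx : χ (x, t) ≤ 2 / c := by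
    rw [hχeq (hsub hxK) hx]
    exact (speedWeight_bounds hc (hmc (hsub hxK) hx).1 (hmc (hsub hxK) hx).2).2.1
  have hfin := hle hxK
  rw [← hNeq hxK] at hfin
  calc _ ≤ M * χ (x, t) := hfin
    _ ≤ 2 / c * (threshold α c a * max I 1) * (2 / c) :=
      mul_le_mul hMle hχx (hχpos _).le (hM0.trans hMle)
    _ = _ := by ring

end IsGraphicalFlowBelow

end HFlow

theorem mainTheorem3 (α c w₀ a : ℝ) (hα : 0 < α) (hc : 0 < c) (hw₀ : 0 < w₀) :
    ∃ C : ℝ, 0 < C ∧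
      ∀ (n : ℕ) (T : EReal) (u : HFlow.Base n → ℝ → EReal),
        HFlow.IsGraphicalFlowBelow α a T u →
        (∀ p ∈ HFlow.belowHeight T u a, 2 * w₀ ≤ HFlow.graphW (HFlow.slice u p.2) p.1) →
        (∀ p ∈ HFlow.belowHeight T u a,
          c ≤ 1 / 2 * HFlow.graphH (HFlow.slice u p.2) p.1 ^ α ∧
          1 / 2 * HFlow.graphH (HFlow.slice u p.2) p.1 ^ α ≤ c⁻¹) →
        BddAbove (Set.range fun y : HFlow.Base n =>
          HFlow.cutoff u a y 0 * HFlow.graphA (HFlow.slice u 0) y) ∧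
        ∀ t ∈ HFlow.timeInterval T, ∀ x : HFlow.Base n,
          HFlow.cutoff u a x t * HFlow.graphA (HFlow.slice u t) x ≤
            C * max (⨆ y : HFlow.Base n,
              HFlow.cutoff u a y 0 * HFlow.graphA (HFlow.slice u 0) y) 1 := by
  refine ⟨4 / c ^ 2 * HFlow.threshold α c a, ?_, fun n T u hu _ hH => ?_⟩
  · have := HFlow.one_le_threshold (a := a) hα hc
    positivity
  · have hb := hu.bddAbove_initial
    exact ⟨hb, fun t ht x => hu.curvature_estimate hα hc hH (fun y => le_ciSup hb y) ht x⟩
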